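/- Let $\beta\in\{1,2,4\}$, let $\mathbb K_\beta=\mathbb R,\mathbb C,\mathbb H$ for $\beta=1,2,4$ respectively, and let $n\ge 2$ be an integer. Regard $\mathbb K_\beta^{n\times 2}$ as a real vector space of dimension $2\beta n$, let $$\mathrm{St}=\mathrm{St}^{(\beta)}(n,n-2)=\{A\in\mathbb K_\beta^{n\times 2} : A^\dagger A=1_2\},$$ and let $\int_{\mathrm{St}}$ denote the integral over $\mathrm{St}$ with respect to the probability measure invariant under $A\mapsto UA$ for all $U\in\mathbb K_\beta^{n\times n}$ with $U^\dagger U=UU^\dagger=1_n$ (so $U$ ranges over $\mathrm O(n)$, $\mathrm U(n)$, $\mathrm{USp}(2n)$; in particular, for $\beta=1$, $n=2$ the integral is over all of $\mathrm O(2)$). Let $\mathcal A^{(\beta)}(n,n-2)$ be the class of complex-valued functions $f$ that are $C^\infty$ on some open set $\Omega\subset\mathbb K_\beta^{n\times 2}$ containing $\{\lambda A: A\in\mathrm{St},\ \lambda\in[0,1]\}$ and whose Taylor series at the origin, $\sum_{d\ge0}\frac1{d!}D^df(0)[A,\dots,A]$, converges to $f$ uniformly for $A\in\Omega$. Let $\nabla$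 be the matrix of first order differential operators with entries $\partial/\partial A_{ji}$ for $\beta=1$ and $2\,\partial/\partial A_{ji}=\partial_x-\imath\,\partial_y$ (where $A_{ji}=x+\imath y$) for $\beta=2$. For $\beta=4$, identify $\mathbb H^{n\times 2}$ with a real subspace of $\mathbb C^{2n\times 4}$ by replacing each quaternion $a+bi+cj+dk$ by the block $\begin{pmatrix} a+\imath b& c+\imath d\\ -c+\imath d& a-\imath b\end{pmatrix}$, and let $\nabla$ be the $2n\times 4$ matrix with the corresponding blocks $$\begin{pmatrix}\partial_a-\imath\partial_b& \partial_c-\imath\partial_d\\ -\partial_c-\imath\partial_d& \partial_a+\imath\partial_b\end{pmatrix}.$$ Let $\nabla^\dagger$ be the transpose of $\nabla$ with complex conjugated coefficients (the real partial derivatives being left unchanged). Put $$I_1=\mathrm{tr}(\nabla^\dagger\nabla),\quad I_2=\det(\nabla^\dagger\nabla)\quad(\beta=1,2),\qquad I_1=\tfrac12\,\mathrm{tr}(\nabla^\dagger\nabla),\quad I_2=\mathrm{Pf}(I\,\nabla^\dagger\nabla)\quad(\beta=4),$$ where for $\beta=4$ the trace is that of the complex $4\times4$ matrix, $I=\mathrm{diag}\left(\begin{pmatrix}0&1\\-1&0\end{pmatrix},\begin{pmatrix}0&1\\-1&0\end{pmatrix}\right)$,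 and $\mathrm{Pf}\,C=\frac{1}{N!}\sum_{\omega\in\mathcal S_{2N}}\mathrm{sign}\,\omega\prod_{j=1}^N\frac{C_{\omega(2j-1)\omega(2j)}}{2}$. Thus $I_1$ is in every case the Laplacian of the $2\beta n$ real coordinates. Then $\mathcal A^{(\beta)}(n,n-2)$ contains all complex-valued polynomial functions of the real coordinates, and for every $f\in\mathcal A^{(\beta)}(n,n-2)$ $$\int_{\mathrm{St}^{(\beta)}(n,n-2)}f=\sum_{j=0}^{\infty}\frac{\Gamma(\beta n/2)}{4^j\,\Gamma(j+\beta n/2)}\sum_{l=0}^{\lfloor j/2\rfloor}\frac{\Gamma(\beta(n-1)/2)}{\Gamma(l+\beta(n-1)/2)}\left(\frac{I_1^{\,j-2l}}{(j-2l)!}\,\frac{I_2^{\,l}}{l!}\,f\right)(0),$$ where the series over $j$ converges (absolutely) to the left-hand side. -/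

import Mathlib

open MeasureTheory Filter Topology
open scoped Matrix Quaternion ContDiff

namespace Pizzetti

/-! ### Stiefel manifolds and their invariant probability measure

The scalars `K` are `ℝ`, `ℂ` or `ℍ[ℝ]`. Rectangular matrices carry their usual (product) topology
and the Borel σ-algebra. -/

instance instMeasurableSpaceMatrix {K : Type*} [TopologicalSpace K] (n k : ℕ) :
    MeasurableSpace (Matrix (Fin n) (Fin k) K) := borel _

instance instBorelSpaceMatrix {K : Type*} [TopologicalSpace K] (n k : ℕ) :
    BorelSpace (Matrix (Fin n) (Fin k) K) := ⟨rfl⟩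

/-- The Stiefel manifold of `n × k` matrices with orthonormal columns. -/
def stiefel (K : Type*) [Ring K] [StarRing K] (n k : ℕ) : Set (Matrix (Fin n) (Fin k) K) :=
  {A | Aᴴ * A = 1}

/-- The `n × k` matrix formed by the first `k` columns of the unit matrix. -/
def frame (K : Type*) [Ring K] (n k : ℕ) : Matrix (Fin n) (Fin k) K :=
  Matrix.of fun i j => if (i : ℕ) = (j : ℕ) then 1 else 0

/-- The group of square matrices `U` with `Uᴴ * U = U * Uᴴ = 1`: it is the orthogonal group for
`ℝ`, the unitary group for `ℂ`, and the compact symplectic group for `ℍ[ℝ]`. -/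
abbrev unitaryGp (K : Type*) [Ring K] [StarRing K] (n : ℕ) : Type _ :=
  unitary (Matrix (Fin n) (Fin n) K)

theorem compactSpace_unitaryGp {K : Type*} [NormedRing K] [StarRing K] [ContinuousStar K]
    [ProperSpace K] (n : ℕ) (φ : K →+ ℝ) (hφ : ∀ a : K, φ (star a * a) = ‖a‖ ^ 2) :
    CompactSpace (unitaryGp K n) := by
  refine isCompact_iff_compactSpace.mp ?_
  have hK : IsCompact {A : Matrix (Fin n) (Fin n) K |
      ∀ i, A i ∈ {v : Fin n → K | ∀ j, v j ∈ Metric.closedBall (0 : K) (Real.sqrt (φ 1))}} :=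
    isCompact_pi_infinite fun _ => isCompact_pi_infinite fun _ => isCompact_closedBall _ _
  refine hK.of_isClosed_subset isClosed_unitary ?_
  intro U hU i j
  have h1 : star U * U = 1 := (Unitary.mem_iff.mp hU).1
  rw [mem_closedBall_zero_iff]
  refine Real.le_sqrt_of_sq_le ?_
  have h2 := congrArg (fun M : Matrix (Fin n) (Fin n) K => φ (M j j)) h1
  simp only [Matrix.mul_apply, Matrix.star_eq_conjTranspose, Matrix.conjTranspose_apply,
    map_sum, hφ, Matrix.one_apply_eq] at h2
  rw [← h2]
  exact Finset.single_le_sum (f := fun x => ‖U x j‖ ^ 2) (fun x _ => sq_nonneg _)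
    (Finset.mem_univ i)

instance instCompactSpaceReal (n : ℕ) : CompactSpace (unitaryGp ℝ n) :=
  compactSpace_unitaryGp n (AddMonoidHom.id ℝ) fun a => by simp [sq]

instance instCompactSpaceComplex (n : ℕ) : CompactSpace (unitaryGp ℂ n) :=
  compactSpace_unitaryGp n Complex.reLm.toAddMonoidHom fun a => by
    rw [← Complex.normSq_eq_norm_sq]
    simp [Complex.normSq_apply]

instance instCompactSpaceQuaternion (n : ℕ) : CompactSpace (unitaryGp ℍ[ℝ] n) :=
  haveI : ProperSpace ℍ[ℝ] := FiniteDimensional.proper ℝ ℍ[ℝ]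
  compactSpace_unitaryGp n
    (⟨⟨fun a => a.re, Quaternion.re_zero⟩, Quaternion.re_add⟩ : ℍ[ℝ] →+ ℝ) fun a => by
    have h := Quaternion.normSq_eq_norm_mul_self a
    rw [sq, ← h, Quaternion.star_mul_self]
    exact Quaternion.re_coe _

/-- The invariant probability measure of the Stiefel manifold, as a measure on the space of all
`n × k` matrices: the image of the normalized Haar measure of the group under its (transitive)
action `U ↦ U * frame` on the Stiefel manifold. -/
noncomputable def stiefelMeasure (K : Type*) [NormedRing K] [StarRing K] [ContinuousStar K]
    (n k : ℕ) [CompactSpace (unitaryGp K n)] : Measure (Matrix (Fin n) (Fin k) K) :=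
  (Measure.haarMeasure (⊤ : TopologicalSpace.PositiveCompacts (unitaryGp K n))).map
    fun U : unitaryGp K n => (U : Matrix (Fin n) (Fin n) K) * frame K n k

/-! ### The class of functions

Derivatives are taken with respect to the entrywise sup norm on matrices. -/

open scoped Matrix.Norms.Elementwise

/-- `f` is smooth on an open set `Ω` which contains `t • A` for all `A` in the Stiefel manifold and
`t ∈ [0, 1]`, and the Taylor series of `f` at the origin converges to `f` uniformly on `Ω`. -/
def InAnalyticClass {K : Type*} [NormedRing K] [StarRing K] [NormedAlgebra ℝ K] {n k : ℕ}
    (f : Matrix (Fin n) (Fin k) K → ℂ) : Prop :=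
  ∃ Ω : Set (Matrix (Fin n) (Fin k) K), IsOpen Ω ∧
    (∀ A ∈ stiefel K n k, ∀ t ∈ Set.Icc (0 : ℝ) 1, t • A ∈ Ω) ∧
    ContDiffOn ℝ ∞ f Ω ∧
    TendstoUniformlyOn
      (fun N A => ∑ d ∈ Finset.range (N + 1),
        ((d.factorial : ℝ)⁻¹) • iteratedFDeriv ℝ d f 0 (fun _ => A)) f atTop Ω

/-! ### Real coordinates and differential operators with constant coefficients -/

/-- Labels of the real coordinates of an `n × k` matrix whose entries have `β` real components:
row, column, component. -/
abbrev Coord (n k β : ℕ) : Type := Fin n × Fin k × Fin β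

/-- The standard real basis of the scalars `ℝ`. -/
def realUnits : Fin 1 → ℝ := ![1]

/-- The standard real basis of the scalars `ℂ`. -/
noncomputable def complexUnits : Fin 2 → ℂ := ![1, Complex.I]

/-- The standard real basis `1, i, j, k` of the scalars `ℍ[ℝ]`. -/
def quaternionUnits : Fin 4 → ℍ[ℝ] := ![⟨1, 0, 0, 0⟩, ⟨0, 1, 0, 0⟩, ⟨0, 0, 1, 0⟩, ⟨0, 0, 0, 1⟩]

/-- The matrix that spans the direction of the real coordinate `c`. -/
def direction {K : Type*} [Ring K] {n k β : ℕ} (e : Fin β → K) (c : Coord n k β) :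
    Matrix (Fin n) (Fin k) K :=
  Matrix.single c.1 c.2.1 (e c.2.2)

/-- `f` is a (complex valued) polynomial function of the real coordinates of a matrix. -/
def IsPolynomialFunction {K : Type*} [NormedRing K] [NormedAlgebra ℝ K] {n k β : ℕ}
    (e : Fin β → K) (f : Matrix (Fin n) (Fin k) K → ℂ) : Prop :=
  ∃ p : MvPolynomial (Coord n k β) ℂ, ∀ x : Coord n k β → ℝ,
    f (∑ c, x c • direction e c) = MvPolynomial.eval (fun c => (x c : ℂ)) p

/-- The mixed partial derivative `∂^α f` at the origin, for a multi-index `α` (the order in which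
the directions are listed is irrelevant for smooth functions). -/
noncomputable def partialAtZero {K : Type*} [NormedRing K] [NormedAlgebra ℝ K] {n k β : ℕ}
    (e : Fin β → K) (α : Coord n k β →₀ ℕ) (f : Matrix (Fin n) (Fin k) K → ℂ) : ℂ :=
  iteratedFDeriv ℝ (Finsupp.toMultiset α).toList.length f 0
    fun i => direction e ((Finsupp.toMultiset α).toList.get i)

/-- A polynomial `P` in indeterminates `X c` stands for the differential operator with constant
coefficients in which `X c` is the partial derivative along the real coordinate `c`. This is the
value `(P f)(0)`. -/
noncomputable def applyAtZero {K : Type*} [NormedRing K] [NormedAlgebra ℝ K] {n k β : ℕ}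
    (e : Fin β → K) (P : MvPolynomial (Coord n k β) ℂ) (f : Matrix (Fin n) (Fin k) K → ℂ) : ℂ :=
  ∑ α ∈ P.support, P.coeff α * partialAtZero e α f

/-- The adjoint of a matrix of differential operators: the transpose, with complex conjugated
coefficients (the real partial derivatives are left as they are). -/
noncomputable def dagger {m l σ : Type*} (M : Matrix m l (MvPolynomial σ ℂ)) :
    Matrix l m (MvPolynomial σ ℂ) :=
  (M.map (MvPolynomial.map (starRingEnd ℂ)))ᵀ

/-- The matrix gradient for `ℝ`: the entries are `∂/∂A_{ji}`. -/
noncomputable def nablaReal (n k : ℕ) :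
    Matrix (Fin n) (Fin k) (MvPolynomial (Coord n k 1) ℂ) :=
  Matrix.of fun j i => MvPolynomial.X (j, i, 0)

/-- The matrix gradient for `ℂ`: the entries are `2 ∂/∂A_{ji} = ∂/∂x - I ∂/∂y` (Wirtinger
derivatives), where `A_{ji} = x + I y`. -/
noncomputable def nablaComplex (n k : ℕ) :
    Matrix (Fin n) (Fin k) (MvPolynomial (Coord n k 2) ℂ) :=
  Matrix.of fun j i =>
    MvPolynomial.X (j, i, 0) - MvPolynomial.C Complex.I * MvPolynomial.X (j, i, 1)

/-- The matrix gradient for `ℍ[ℝ]`, as a `2n × 2k` complex matrix: the quaternion `a + bi + cj + dk`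
is embedded as the `2 × 2` block with rows `(a + I b, c + I d)` and `(-c + I d, a - I b)`, and every
entry `z` of a block is replaced by twice the Wirtinger derivative `∂/∂z`. -/
noncomputable def nablaQuaternion (n k : ℕ) :
    Matrix (Fin n × Fin 2) (Fin k × Fin 2) (MvPolynomial (Coord n k 4) ℂ) :=
  Matrix.of fun p q =>
    let d : Fin 4 → MvPolynomial (Coord n k 4) ℂ := fun a => MvPolynomial.X (p.1, q.1, a)
    let I : MvPolynomial (Coord n k 4) ℂ := MvPolynomial.C Complex.I
    !![d 0 - I * d 1, d 2 - I * d 3; -d 2 - I * d 3, d 0 + I * d 1] p.2 q.2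

/-- The Pfaffian of a `2N × 2N` matrix; the index `(j, 0)`, `(j, 1)` is the position `2j - 1`, `2j`
of the usual numbering. -/
noncomputable def pfaffian {R : Type*} [CommRing R] [Algebra ℚ R] {N : ℕ}
    (M : Matrix (Fin N × Fin 2) (Fin N × Fin 2) R) : R :=
  ((2 ^ N * N.factorial : ℚ)⁻¹) • ∑ σ : Equiv.Perm (Fin N × Fin 2),
    Equiv.Perm.sign σ • ∏ j : Fin N, M (σ (j, 0)) (σ (j, 1))

/-- The block diagonal matrix with `N` blocks `!![0, 1; -1, 0]`. -/
def symplecticUnit (R : Type*) [CommRing R] (N : ℕ) :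
    Matrix (Fin N × Fin 2) (Fin N × Fin 2) R :=
  Matrix.of fun p q => if p.1 = q.1 then !![0, 1; -1, 0] p.2 q.2 else 0

/-- The invariant operator `I₁ = tr (∇† ∇)` on real `n × 2` matrices. -/
noncomputable def I₁Real (n : ℕ) : MvPolynomial (Coord n 2 1) ℂ :=
  (dagger (nablaReal n 2) * nablaReal n 2).trace

/-- The invariant operator `I₂ = det (∇† ∇)` on real `n × 2` matrices. -/
noncomputable def I₂Real (n : ℕ) : MvPolynomial (Coord n 2 1) ℂ :=
  (dagger (nablaReal n 2) * nablaReal n 2).det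

/-- The invariant operator `I₁ = tr (∇† ∇)` on complex `n × 2` matrices. -/
noncomputable def I₁Complex (n : ℕ) : MvPolynomial (Coord n 2 2) ℂ :=
  (dagger (nablaComplex n 2) * nablaComplex n 2).trace

/-- The invariant operator `I₂ = det (∇† ∇)` on complex `n × 2` matrices. -/
noncomputable def I₂Complex (n : ℕ) : MvPolynomial (Coord n 2 2) ℂ :=
  (dagger (nablaComplex n 2) * nablaComplex n 2).det

/-- The invariant operator `I₁ = tr (∇† ∇)` on quaternionic `n × 2` matrices; here the trace is the
quaternionic one, which is half of the trace of the complex `4 × 4` matrix. -/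
noncomputable def I₁Quaternion (n : ℕ) : MvPolynomial (Coord n 2 4) ℂ :=
  MvPolynomial.C (1 / 2) * (dagger (nablaQuaternion n 2) * nablaQuaternion n 2).trace

/-- The invariant operator `I₂ = Pf (I ∇† ∇)` on quaternionic `n × 2` matrices. -/
noncomputable def I₂Quaternion (n : ℕ) : MvPolynomial (Coord n 2 4) ℂ :=
  pfaffian (symplecticUnit _ 2 * (dagger (nablaQuaternion n 2) * nablaQuaternion n 2))

/-- The `j`-th term of the series, `β` being the number of real components of a scalar. -/
noncomputable def pizzettiTerm {K : Type*} [NormedRing K] [NormedAlgebra ℝ K] {n β : ℕ}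
    (e : Fin β → K) (I₁ I₂ : MvPolynomial (Coord n 2 β) ℂ)
    (f : Matrix (Fin n) (Fin 2) K → ℂ) (j : ℕ) : ℂ :=
  ((Real.Gamma (β * n / 2) / (4 ^ j * Real.Gamma (j + β * n / 2)) : ℝ) : ℂ) *
    ∑ l ∈ Finset.range (j / 2 + 1),
      ((Real.Gamma (β * (n - 1) / 2) / Real.Gamma (l + β * (n - 1) / 2) : ℝ) : ℂ) *
        (applyAtZero e (I₁ ^ (j - 2 * l) * I₂ ^ l) f /
          ((j - 2 * l).factorial * l.factorial))

end Pizzetti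

set_option linter.unusedSectionVars false

namespace Pizzetti

/-! ### Real structure of the scalars -/

/-! Write `n = m + 2`, `v = β(n-1)/2`, `N = βn/2`. The Taylor series converges uniformly on an open
set containing the compact orbit, hence also on a slightly dilated copy of it; homogeneity then
bounds the terms on the orbit by a geometric series, so the series may be integrated term by term.
Odd degrees vanish under `A ↦ -A`. The integral of the component of degree `2j` is a constant
coefficient operator applied to `f` at `0`, and its symbol at a matrix `B` is, up to the factor
`1/(2j)!`, the integral of `(re tr A†B)^(2j)`. The theorem thus amounts to one polynomial identity
in `B` for each `j` (`integral_re_trace_pow`).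

Both sides of that identity are invariant under `B ↦ U B V`, so by the singular value decomposition
(`matrix_two_columns_induction`) `B` may be taken diagonal with real entries `s, t`. The integrand
becomes `(s x + t y)^(2j)` with `x = re A₀₀`, `y = re A₁₁`, and only the moments of `x^a y^b` are
needed. Differentiating the invariance of the measure along rotations of rows and of columns gives
linear relations between these moments and moments containing the off-diagonal entries. The latter
are eliminated by comparing left with right rotations and by the unit length of the first column.
What remains is a recurrence (`moment_recurrence`) with a unique solution
(`eq_momentValue_of_recurrence`), namely `momentValue`, a quotient of rising factorials of `v` and
`N`.

Finally a Chu–Vandermonde summation rewrites the sum over monomials `s^(2p) t^(2j-2p)` as a sum over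
powers of `s² + t²` and `s² t²`. These are the values at `B` of `gramTrace` and `gramDet`, which are
the symbols of `I₁` and `I₂`. All three scalar systems are treated at once through `IsScalarSystem`;
only the evaluation of the symbols is done case by case. -/

/-- The properties shared by `ℝ`, `ℂ` and `ℍ[ℝ]`: `re` is a trace, `star` is an involution whose
norm form `star a * a` is real, and `e` is an orthonormal basis made of `1` and imaginary units. -/
structure IsScalarSystem {K : Type*} [NormedRing K] [StarRing K] [NormedAlgebra ℝ K] {β : ℕ}
    [NeZero β] (e : Fin β → K) (re : K →ₗ[ℝ] ℝ) : Prop where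
  star_smul : ∀ (r : ℝ) (a : K), star (r • a) = r • star a
  re_mul_comm : ∀ a b : K, re (a * b) = re (b * a)
  re_star : ∀ a : K, re (star a) = re a
  star_mul_self : ∀ a : K, star a * a = re (star a * a) • (1 : K)
  mul_star_self : ∀ a : K, a * star a = re (star a * a) • (1 : K)
  eq_sum : ∀ a : K, a = ∑ c, re (star (e c) * a) • e c
  re_star_mul : ∀ c d, re (star (e c) * e d) = if c = d then 1 else 0
  unit_zero : e 0 = 1
  star_unit : ∀ c, c ≠ 0 → star (e c) = -e c

theorem isScalarSystem_real : IsScalarSystem realUnits (LinearMap.id : ℝ →ₗ[ℝ] ℝ) where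
  star_smul r a := by simp
  re_mul_comm a b := mul_comm _ _
  re_star a := by simp
  star_mul_self a := by simp
  mul_star_self a := by simp
  eq_sum a := by simp [realUnits]
  re_star_mul c d := by simp [realUnits, Subsingleton.elim c d]
  unit_zero := by simp [realUnits]
  star_unit c hc := absurd (Subsingleton.elim _ _) hc

theorem isScalarSystem_complex : IsScalarSystem complexUnits Complex.reLm where
  star_smul r a := by simp
  re_mul_comm a b := by rw [mul_comm]
  re_star a := by simp
  star_mul_self a := by apply Complex.ext <;> simp; ring
  mul_star_self a := by apply Complex.ext <;> simp; ring
  eq_sum a := by simp [complexUnits, Fin.sum_univ_two]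
  re_star_mul c d := by fin_cases c <;> fin_cases d <;> simp [complexUnits]
  unit_zero := by simp [complexUnits]
  star_unit c hc := by fin_cases c <;> simp [complexUnits] at hc ⊢

/-- The real part of a quaternion, as a linear map. -/
def quaternionRe : ℍ[ℝ] →ₗ[ℝ] ℝ where
  toFun a := a.re
  map_add' _ _ := rfl
  map_smul' _ _ := rfl

@[simp] theorem quaternionRe_apply (a : ℍ[ℝ]) : quaternionRe a = a.re := rfl

theorem quaternionUnits_re (c : Fin 4) : (quaternionUnits c).re = if c = 0 then 1 else 0 := by
  fin_cases c <;> rfl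

theorem quaternionUnits_imI (c : Fin 4) : (quaternionUnits c).imI = if c = 1 then 1 else 0 := by
  fin_cases c <;> rfl

theorem quaternionUnits_imJ (c : Fin 4) : (quaternionUnits c).imJ = if c = 2 then 1 else 0 := by
  fin_cases c <;> rfl

theorem quaternionUnits_imK (c : Fin 4) : (quaternionUnits c).imK = if c = 3 then 1 else 0 := by
  fin_cases c <;> rfl

theorem isScalarSystem_quaternion : IsScalarSystem quaternionUnits quaternionRe where
  star_smul r a := by ext <;> simp
  re_mul_comm a b := by simp; ring
  re_star a := by simp
  star_mul_self a := by ext <;> simp <;> ring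
  mul_star_self a := by ext <;> simp <;> ring
  eq_sum a := by
    ext <;> simp [Fin.sum_univ_four, quaternionUnits_re, quaternionUnits_imI,
      quaternionUnits_imJ, quaternionUnits_imK]
  re_star_mul c d := by
    simp only [quaternionRe_apply, Quaternion.re_mul, Quaternion.re_star, Quaternion.imI_star,
      Quaternion.imJ_star, Quaternion.imK_star, quaternionUnits_re, quaternionUnits_imI,
      quaternionUnits_imJ, quaternionUnits_imK]
    fin_cases c <;> fin_cases d <;> simp
  unit_zero := by
    ext <;> simp [quaternionUnits_re, quaternionUnits_imI, quaternionUnits_imJ,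
      quaternionUnits_imK]
  star_unit c hc := by
    ext <;> simp [quaternionUnits_re, quaternionUnits_imI, quaternionUnits_imJ,
      quaternionUnits_imK, hc]

namespace IsScalarSystem

variable {K : Type*} [NormedRing K] [StarRing K] [NormedAlgebra ℝ K] {β : ℕ} [NeZero β]
  {e : Fin β → K} {re : K →ₗ[ℝ] ℝ}

theorem re_one (S : IsScalarSystem e re) : re 1 = 1 := by
  simpa [S.unit_zero] using S.re_star_mul 0 0

theorem re_star_mul_self_unit (S : IsScalarSystem e re) (c : Fin β) :
    re (star (e c) * e c) = 1 := by simpa using S.re_star_mul c c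

theorem star_mul_unit (S : IsScalarSystem e re) (c : Fin β) : star (e c) * e c = 1 := by
  rw [S.star_mul_self, S.re_star_mul_self_unit, one_smul]

theorem mul_star_unit (S : IsScalarSystem e re) (c : Fin β) : e c * star (e c) = 1 := by
  rw [S.mul_star_self, S.re_star_mul_self_unit, one_smul]

/-- The norm form is the sum of the squares of the real components. -/
theorem re_star_mul_self (S : IsScalarSystem e re) (a : K) :
    re (star a * a) = ∑ c, re (star (e c) * a) ^ 2 := by
  conv_lhs => rw [S.eq_sum a]
  rw [Finset.mul_sum, map_sum]
  refine Finset.sum_congr rfl fun c _ => ?_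
  have h : re (star a * e c) = re (star (e c) * a) := by
    rw [← S.re_star, star_mul, star_star]
  rw [← S.eq_sum, mul_smul_comm, map_smul, h, smul_eq_mul, sq]

theorem re_star_mul_self_nonneg (S : IsScalarSystem e re) (a : K) : 0 ≤ re (star a * a) := by
  rw [S.re_star_mul_self]; positivity

theorem eq_zero_of_re_star_mul_self (S : IsScalarSystem e re) {a : K}
    (h : re (star a * a) = 0) : a = 0 := by
  rw [S.re_star_mul_self, Finset.sum_eq_zero_iff_of_nonneg fun _ _ => sq_nonneg _] at h
  rw [S.eq_sum a]
  exact Finset.sum_eq_zero fun c hc => by rw [pow_eq_zero_iff two_ne_zero |>.1 (h c hc), zero_smul]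

theorem finiteDimensional (S : IsScalarSystem e re) : FiniteDimensional ℝ K := by
  suffices h : Submodule.span ℝ (Set.range e) = ⊤ from
    ⟨h ▸ Submodule.fg_span (Set.finite_range e)⟩
  rw [eq_top_iff]
  intro a _
  rw [S.eq_sum a]
  exact Submodule.sum_mem _ fun c _ =>
    Submodule.smul_mem _ _ (Submodule.subset_span (Set.mem_range_self c))

theorem starModule (S : IsScalarSystem e re) : StarModule ℝ K :=
  ⟨fun r a => by rw [S.star_smul, star_trivial r]⟩

/-- The polar decomposition of a scalar. -/
theorem exists_unit_mul (S : IsScalarSystem e re) (a : K) :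
    ∃ u : K, star u * u = 1 ∧ u * star u = 1 ∧ ∃ r : ℝ, u * a = r • (1 : K) := by
  by_cases ha : re (star a * a) = 0
  · refine ⟨1, by simp, by simp, 0, ?_⟩
    simp [S.eq_zero_of_re_star_mul_self ha]
  · set r := Real.sqrt (re (star a * a)) with hr
    have hr2 : r * r = re (star a * a) := Real.mul_self_sqrt (S.re_star_mul_self_nonneg a)
    have hr0 : r ≠ 0 := by
      intro h
      rw [h] at hr2
      exact ha (by rw [← hr2, zero_mul])
    refine ⟨r⁻¹ • star a, ?_, ?_, r, ?_⟩
    · rw [S.star_smul, star_star, smul_mul_smul_comm, S.mul_star_self, ← hr2, smul_smul]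
      field_simp
      simp
    · rw [S.star_smul, star_star, smul_mul_smul_comm, S.star_mul_self, ← hr2, smul_smul]
      field_simp
      simp
    · rw [smul_mul_assoc, S.star_mul_self, ← hr2, smul_smul]
      field_simp

end IsScalarSystem

/-! ### Invariance of the measure -/

section Measure

variable {K : Type*} [NormedRing K] [StarRing K] [ContinuousStar K] {n k : ℕ}
  [CompactSpace (unitaryGp K n)]

instance isProbabilityMeasure_haarMeasure_top {G : Type*} [Group G] [TopologicalSpace G]
    [IsTopologicalGroup G] [CompactSpace G] [MeasurableSpace G] [BorelSpace G] :
    IsProbabilityMeasure (Measure.haarMeasure (⊤ : TopologicalSpace.PositiveCompacts G)) :=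
  ⟨by simpa using Measure.haarMeasure_self (K₀ := (⊤ : TopologicalSpace.PositiveCompacts G))⟩

/-- A right translate of Haar measure is again a left-invariant probability measure, so uniqueness
forces equality: compact groups are unimodular. -/
theorem isMulRightInvariant_haarMeasure_top {G : Type*} [Group G] [TopologicalSpace G]
    [IsTopologicalGroup G] [CompactSpace G] [MeasurableSpace G] [BorelSpace G] :
    (Measure.haarMeasure (⊤ : TopologicalSpace.PositiveCompacts G)).IsMulRightInvariant where
  map_mul_right_eq_self g := by
    have : IsProbabilityMeasure
        ((Measure.haarMeasure (⊤ : TopologicalSpace.PositiveCompacts G)).map (· * g)) :=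
      Measure.isProbabilityMeasure_map (by fun_prop)
    exact Measure.isHaarMeasure_eq_of_isProbabilityMeasure _ _

theorem continuous_mul_frame :
    Continuous fun U : unitaryGp K n => (U : Matrix (Fin n) (Fin n) K) * frame K n k :=
  continuous_subtype_val.matrix_mul continuous_const

instance isProbabilityMeasure_stiefelMeasure : IsProbabilityMeasure (stiefelMeasure K n k) :=
  Measure.isProbabilityMeasure_map continuous_mul_frame.measurable.aemeasurable

theorem conjTranspose_frame_mul_frame (hk : k ≤ n) : (frame K n k)ᴴ * frame K n k = 1 := by
  ext i j
  simp only [Matrix.mul_apply, Matrix.conjTranspose_apply, frame, Matrix.of_apply,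
    Matrix.one_apply]
  rw [Finset.sum_eq_single (Fin.castLE hk i)]
  · simp [Fin.ext_iff]
  · intro b _ hb
    have : (b : ℕ) ≠ i := fun h => hb (Fin.ext (by simpa using h))
    simp [this]
  · simp

theorem mul_mem_stiefel (U : unitaryGp K n) {A : Matrix (Fin n) (Fin k) K}
    (hA : A ∈ stiefel K n k) : (U : Matrix (Fin n) (Fin n) K) * A ∈ stiefel K n k := by
  have hA' : Aᴴ * A = 1 := hA
  change ((U : Matrix (Fin n) (Fin n) K) * A)ᴴ * ((U : Matrix (Fin n) (Fin n) K) * A) = 1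
  rw [Matrix.conjTranspose_mul, Matrix.mul_assoc,
    ← Matrix.mul_assoc (U : Matrix (Fin n) (Fin n) K)ᴴ,
    ← Matrix.star_eq_conjTranspose (U : Matrix (Fin n) (Fin n) K),
    (Unitary.mem_iff.1 U.2).1, Matrix.one_mul, hA']

theorem isClosed_stiefel : IsClosed (stiefel K n k) :=
  isClosed_eq (continuous_id.matrix_conjTranspose.matrix_mul continuous_id) continuous_const

theorem ae_mem_stiefel (hk : k ≤ n) : ∀ᵐ A ∂(stiefelMeasure K n k), A ∈ stiefel K n k := by
  refine (ae_map_iff continuous_mul_frame.measurable.aemeasurable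
    isClosed_stiefel.measurableSet).2 ?_
  exact Eventually.of_forall fun U => mul_mem_stiefel U (conjTranspose_frame_mul_frame hk)

theorem frame_mem_stiefel (hk : k ≤ n) : frame K n k ∈ stiefel K n k :=
  conjTranspose_frame_mul_frame hk

variable {E : Type*} [NormedAddCommGroup E] [NormedSpace ℝ E] [SecondCountableTopology E]

theorem integral_stiefelMeasure {F : Matrix (Fin n) (Fin k) K → E} (hF : Continuous F) :
    ∫ A, F A ∂(stiefelMeasure K n k) =
      ∫ U : unitaryGp K n, F ((U : Matrix (Fin n) (Fin n) K) * frame K n k)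
        ∂(Measure.haarMeasure (⊤ : TopologicalSpace.PositiveCompacts (unitaryGp K n))) := by
  borelize E
  exact integral_map continuous_mul_frame.measurable.aemeasurable
    hF.measurable.stronglyMeasurable.aestronglyMeasurable

theorem integral_mul_left {F : Matrix (Fin n) (Fin k) K → E} (hF : Continuous F)
    {U : Matrix (Fin n) (Fin n) K} (hU : U ∈ unitary (Matrix (Fin n) (Fin n) K)) :
    ∫ A, F (U * A) ∂(stiefelMeasure K n k) = ∫ A, F A ∂(stiefelMeasure K n k) := by
  rw [integral_stiefelMeasure hF, integral_stiefelMeasure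
    (F := fun A => F (U * A)) (hF.comp (continuous_const.matrix_mul continuous_id)),
    ← integral_mul_left_eq_self (fun W : unitaryGp K n => F (W.1 * frame K n k))
      (⟨U, hU⟩ : unitaryGp K n)]
  simp [Matrix.mul_assoc]

/-- A unitary matrix acting on the columns of `frame` comes from one acting on the rows. -/
theorem exists_frame_mul_eq (hk : k ≤ n) {V : Matrix (Fin k) (Fin k) K}
    (hV : V ∈ unitary (Matrix (Fin k) (Fin k) K)) :
    ∃ U ∈ unitary (Matrix (Fin n) (Fin n) K), frame K n k * V = U * frame K n k := by
  obtain ⟨h1, h2⟩ := Unitary.mem_iff.1 hV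
  rw [Matrix.star_eq_conjTranspose] at h1 h2
  have hF := conjTranspose_frame_mul_frame (K := K) hk
  set T := frame K n k with hT
  -- The witness `T V Tᴴ + (1 - T Tᴴ)` is the block matrix `diag(V, 1)`: it acts as `V` on the range
  -- of the projection `T Tᴴ` and as the identity on the complement.
  have key : ∀ V₁ V₂ : Matrix (Fin k) (Fin k) K, V₁ * V₂ = 1 →
      (T * V₁ * Tᴴ + (1 - T * Tᴴ)) * (T * V₂ * Tᴴ + (1 - T * Tᴴ)) = 1 := by
    intro V₁ V₂ h
    have e1 : T * V₁ * Tᴴ * (T * V₂ * Tᴴ) = T * Tᴴ := by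
      calc _ = T * V₁ * (Tᴴ * T) * V₂ * Tᴴ := by simp only [Matrix.mul_assoc]
        _ = T * (V₁ * V₂) * Tᴴ := by rw [hF]; simp only [Matrix.mul_assoc, Matrix.one_mul]
        _ = _ := by rw [h, Matrix.mul_one]
    have e2 : ∀ W : Matrix (Fin k) (Fin k) K, T * Tᴴ * (T * W * Tᴴ) = T * W * Tᴴ := by
      intro W
      calc _ = T * (Tᴴ * T) * W * Tᴴ := by simp only [Matrix.mul_assoc]
        _ = _ := by rw [hF, Matrix.mul_one]
    have e3 : ∀ W : Matrix (Fin k) (Fin k) K, T * W * Tᴴ * (T * Tᴴ) = T * W * Tᴴ := by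
      intro W
      calc _ = T * W * (Tᴴ * T) * Tᴴ := by simp only [Matrix.mul_assoc]
        _ = _ := by rw [hF, Matrix.mul_one]
    have e4 : T * Tᴴ * (T * Tᴴ) = T * Tᴴ := by simpa using e2 1
    simp only [add_mul, mul_add, mul_sub, sub_mul, e1, e2, e3, e4, Matrix.mul_one, Matrix.one_mul]
    simp
  refine ⟨T * V * Tᴴ + (1 - T * Tᴴ), ?_, ?_⟩
  · have hs : star (T * V * Tᴴ + (1 - T * Tᴴ)) = T * Vᴴ * Tᴴ + (1 - T * Tᴴ) := by
      rw [Matrix.star_eq_conjTranspose]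
      simp [Matrix.mul_assoc]
    rw [Unitary.mem_iff, hs]
    exact ⟨key _ _ h1, key _ _ h2⟩
  · rw [Matrix.add_mul, Matrix.sub_mul, Matrix.one_mul, Matrix.mul_assoc _ _ T, hF,
      Matrix.mul_assoc T _ T, hF]
    simp

/-- Right multiplication of the frame by `V` is left multiplication by some `U`, so the substitution
is a right translation on the group, where Haar measure is also right-invariant. -/
theorem integral_mul_right (hk : k ≤ n) {F : Matrix (Fin n) (Fin k) K → E} (hF : Continuous F)
    {V : Matrix (Fin k) (Fin k) K} (hV : V ∈ unitary (Matrix (Fin k) (Fin k) K)) :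
    ∫ A, F (A * V) ∂(stiefelMeasure K n k) = ∫ A, F A ∂(stiefelMeasure K n k) := by
  obtain ⟨U, hU, h⟩ := exists_frame_mul_eq hk hV
  have := isMulRightInvariant_haarMeasure_top (G := unitaryGp K n)
  rw [integral_stiefelMeasure hF, integral_stiefelMeasure
    (F := fun A => F (A * V)) (hF.comp (continuous_id.matrix_mul continuous_const)),
    ← integral_mul_right_eq_self (fun W : unitaryGp K n => F (W.1 * frame K n k))
      (⟨U, hU⟩ : unitaryGp K n)]
  simp [Matrix.mul_assoc, h]

theorem isCompact_range_mul_frame :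
    IsCompact (Set.range fun U : unitaryGp K n =>
      (U : Matrix (Fin n) (Fin n) K) * frame K n k) :=
  isCompact_range continuous_mul_frame

theorem ae_mem_range_mul_frame :
    ∀ᵐ A ∂(stiefelMeasure K n k), A ∈ Set.range fun U : unitaryGp K n =>
      (U : Matrix (Fin n) (Fin n) K) * frame K n k := by
  refine (ae_map_iff continuous_mul_frame.measurable.aemeasurable
    isCompact_range_mul_frame.isClosed.measurableSet).2 ?_
  exact Eventually.of_forall fun U => Set.mem_range_self U

/-- Continuity is enough because the measure lives on the compact orbit of `frame`. -/
theorem integrable_stiefelMeasure {F : Matrix (Fin n) (Fin k) K → E} (hF : Continuous F) :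
    Integrable F (stiefelMeasure K n k) := by
  borelize E
  obtain ⟨C, hC⟩ := (isCompact_range_mul_frame (K := K) (n := n)
    (k := k)).exists_bound_of_continuousOn (f := F) hF.continuousOn
  exact Integrable.of_bound hF.measurable.stronglyMeasurable.aestronglyMeasurable C
    (ae_mem_range_mul_frame.mono fun A hA => hC A hA)

end Measure

/-! ### Infinitesimal invariance -/

/-- `P` is an orthogonal projection and `J` a skew-adjoint complex structure on its range. -/
structure IsRotationPair {R : Type*} [Ring R] [StarRing R] (P J : R) : Prop where
  star_proj : star P = P
  star_gen : star J = -J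
  proj_mul_proj : P * P = P
  proj_mul_gen : P * J = J
  gen_mul_proj : J * P = J
  gen_mul_gen : J * J = -P

/-- Since `J² = -P` and `P J = J`, the matrix is the exponential of `t J`, a one-parameter unitary
group with generator `J`. -/
theorem IsRotationPair.mem_unitary {R : Type*} [Ring R] [StarRing R] [Algebra ℝ R]
    [StarModule ℝ R] {P J : R} (h : IsRotationPair P J) (t : ℝ) :
    1 + (Real.cos t - 1) • P + Real.sin t • J ∈ unitary R := by
  have hs : star (1 + (Real.cos t - 1) • P + Real.sin t • J) =
      1 + (Real.cos t - 1) • P - Real.sin t • J := by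
    simp [h.star_proj, h.star_gen, sub_eq_add_neg]
  have hc : Real.sin t * Real.sin t = 1 - Real.cos t * Real.cos t := by
    nlinarith [Real.sin_sq_add_cos_sq t]
  rw [Unitary.mem_iff, hs]
  constructor
  · simp only [add_mul, mul_add, sub_mul, one_mul, mul_one, smul_mul_smul_comm,
      h.proj_mul_proj, h.proj_mul_gen, h.gen_mul_proj, h.gen_mul_gen, hc]
    module
  · simp only [add_mul, mul_add, mul_sub, one_mul, mul_one, smul_mul_smul_comm,
      h.proj_mul_proj, h.proj_mul_gen, h.gen_mul_proj, h.gen_mul_gen, hc]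
    module

theorem mem_unitary_one_sub_two_mul {R : Type*} [Ring R] [StarRing R] {P : R}
    (h : star P = P) (h' : P * P = P) : 1 - (P + P) ∈ unitary R := by
  have hs : star (1 - (P + P)) = 1 - (P + P) := by simp [h]
  rw [Unitary.mem_iff, hs, and_self]
  simp only [sub_mul, mul_sub, add_mul, mul_add, h', one_mul, mul_one]
  abel

section Pair

variable {K : Type*} [NormedRing K] [StarRing K]

/-- The plane rotations with a phase: their generator is `u E_{ij} - ū E_{ji}`. -/
theorem isRotationPair_single {m : ℕ} {i j : Fin m} (hij : i ≠ j) {u : K} (h : star u * u = 1)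
    (h' : u * star u = 1) :
    IsRotationPair (Matrix.single i i (1 : K) + Matrix.single j j 1)
      (Matrix.single i j u - Matrix.single j i (star u)) := by
  constructor <;>
  simp [Matrix.star_eq_conjTranspose, Matrix.add_mul, Matrix.mul_add, hij, hij.symm, h, h',
    sub_eq_add_neg, add_comm]

theorem isRotationPair_phase {m : ℕ} (i : Fin m) {u : K} (h : star u * u = 1)
    (hs : star u = -u) :
    IsRotationPair (Matrix.single i i (1 : K)) (Matrix.single i i u) := by
  have h2 : u * u = -1 := by rw [hs, neg_mul] at h; rw [← h, neg_neg]
  constructor <;> simp [Matrix.star_eq_conjTranspose, hs, h2, Matrix.single_neg]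

theorem single_sub_single_mul_apply {n k : ℕ} {i j : Fin n} (hij : i ≠ j) (u v : K)
    (A : Matrix (Fin n) (Fin k) K) (r : Fin n) (s : Fin k) :
    ((Matrix.single i j u - Matrix.single j i v) * A : Matrix (Fin n) (Fin k) K) r s =
      if r = i then u * A j s else if r = j then -(v * A i s) else 0 := by
  rw [Matrix.sub_mul, Matrix.sub_apply]
  by_cases h1 : r = i
  · subst h1
    simp [hij]
  · by_cases h2 : r = j
    · subst h2
      simp [hij.symm]
    · simp [h1, h2]

theorem mul_single_sub_single_apply {n k : ℕ} {i j : Fin k} (hij : i ≠ j) (u v : K)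
    (A : Matrix (Fin n) (Fin k) K) (r : Fin n) (s : Fin k) :
    (A * (Matrix.single i j u - Matrix.single j i v) : Matrix (Fin n) (Fin k) K) r s =
      if s = j then A r i * u else if s = i then -(A r j * v) else 0 := by
  rw [Matrix.mul_sub, Matrix.sub_apply]
  by_cases h1 : s = i
  · subst h1
    simp [hij]
  · by_cases h2 : s = j
    · subst h2
      simp [hij.symm]
    · simp [h1, h2]

theorem isSelfAdjoint_single {n : ℕ} (i : Fin n) :
    star (Matrix.single i i (1 : K)) = Matrix.single i i 1 := by
  simp [Matrix.star_eq_conjTranspose]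

end Pair

section Functional

variable {K : Type*} [NormedRing K] [NormedAlgebra ℝ K] {re : K →ₗ[ℝ] ℝ}

/-- The real linear functional `A ↦ re (u * A i j)`. -/
noncomputable def entryRe (re : K →ₗ[ℝ] ℝ) {n k : ℕ} (u : K) (i : Fin n) (j : Fin k) :
    Matrix (Fin n) (Fin k) K →ₗ[ℝ] ℝ :=
  re ∘ₗ LinearMap.mulLeft ℝ u ∘ₗ Matrix.entryLinearMap ℝ K i j

@[simp] theorem entryRe_apply {n k : ℕ} (u : K) (i : Fin n) (j : Fin k)
    (A : Matrix (Fin n) (Fin k) K) : entryRe re u i j A = re (u * A i j) := rfl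

theorem continuous_of_matrix_linearMap [FiniteDimensional ℝ K] {n k : ℕ}
    (f : Matrix (Fin n) (Fin k) K →ₗ[ℝ] ℝ) : Continuous f :=
  f.continuous_of_finiteDimensional

end Functional

section Deriv

variable {K : Type*} [NormedRing K] [StarRing K] [ContinuousStar K] {n k : ℕ}
  [CompactSpace (unitaryGp K n)]

/-- Differentiation under the integral sign for a constant family of integrals. -/
theorem integral_deriv_eq_zero {H H' : ℝ → Matrix (Fin n) (Fin k) K → ℝ}
    (hH : ∀ t, Continuous (H t)) (hH' : Continuous fun p : ℝ × Matrix (Fin n) (Fin k) K => H' p.1 p.2)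
    (hd : ∀ t A, HasDerivAt (fun s => H s A) (H' t A) t)
    (hc : ∀ t, ∫ A, H t A ∂(stiefelMeasure K n k) = ∫ A, H 0 A ∂(stiefelMeasure K n k)) :
    ∫ A, H' 0 A ∂(stiefelMeasure K n k) = 0 := by
  -- The product of `[-1, 1]` and the orbit is compact, so a constant dominates the derivative
  -- there.
  obtain ⟨C, hC⟩ := ((isCompact_Icc (a := (-1 : ℝ)) (b := 1)).prod
    (isCompact_range_mul_frame (K := K) (n := n) (k := k))).exists_bound_of_continuousOn
    hH'.continuousOn
  have h := hasDerivAt_integral_of_dominated_loc_of_deriv_le (μ := stiefelMeasure K n k)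
    (F := H) (F' := H') (x₀ := 0) (bound := fun _ => C)
    (Icc_mem_nhds (show (-1 : ℝ) < 0 by norm_num) (show (0 : ℝ) < 1 by norm_num))
    (Eventually.of_forall fun t => (integrable_stiefelMeasure (hH t)).aestronglyMeasurable)
    (integrable_stiefelMeasure (hH 0))
    (integrable_stiefelMeasure (F := H' 0)
      (hH'.comp (Continuous.prodMk_right 0))).aestronglyMeasurable
    (ae_mem_range_mul_frame.mono fun A hA t ht => hC (t, A) ⟨ht, hA⟩)
    (integrable_const C) (Eventually.of_forall fun A t _ => hd t A)
  have h0 : HasDerivAt (fun t => ∫ A, H t A ∂(stiefelMeasure K n k)) 0 0 := by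
    simp_rw [hc]
    exact hasDerivAt_const _ _
  exact h.2.unique h0

/-- Infinitesimal invariance, tested against a monomial in three real functions. -/
theorem integral_deriv_monomial_eq_zero {x₀ x₁ x₂ y₀ y₁ y₂ z₀ z₁ z₂ : Matrix (Fin n) (Fin k) K → ℝ}
    (hx₀ : Continuous x₀) (hx₁ : Continuous x₁) (hx₂ : Continuous x₂)
    (hy₀ : Continuous y₀) (hy₁ : Continuous y₁) (hy₂ : Continuous y₂)
    (hz₀ : Continuous z₀) (hz₁ : Continuous z₁) (hz₂ : Continuous z₂) (a b : ℕ)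
    (hc : ∀ t, ∫ A, (x₀ A + (Real.cos t - 1) * x₁ A + Real.sin t * x₂ A) ^ a *
      (y₀ A + (Real.cos t - 1) * y₁ A + Real.sin t * y₂ A) ^ b *
      (z₀ A + (Real.cos t - 1) * z₁ A + Real.sin t * z₂ A) ∂(stiefelMeasure K n k) =
        ∫ A, x₀ A ^ a * y₀ A ^ b * z₀ A ∂(stiefelMeasure K n k)) :
    ∫ A, ((a * x₀ A ^ (a - 1) * x₂ A) * y₀ A ^ b + x₀ A ^ a * (b * y₀ A ^ (b - 1) * y₂ A)) * z₀ A
      + x₀ A ^ a * y₀ A ^ b * z₂ A ∂(stiefelMeasure K n k) = 0 := by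
  let f : (Matrix (Fin n) (Fin k) K → ℝ) → (Matrix (Fin n) (Fin k) K → ℝ) →
      (Matrix (Fin n) (Fin k) K → ℝ) → ℝ → Matrix (Fin n) (Fin k) K → ℝ :=
    fun u v w t A => u A + (Real.cos t - 1) * v A + Real.sin t * w A
  let f' : (Matrix (Fin n) (Fin k) K → ℝ) →
      (Matrix (Fin n) (Fin k) K → ℝ) → ℝ → Matrix (Fin n) (Fin k) K → ℝ :=
    fun v w t A => -Real.sin t * v A + Real.cos t * w A
  have hf : ∀ u v w t A, HasDerivAt (fun s => f u v w s A) (f' v w t A) t := fun u v w t A =>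
    ((((Real.hasDerivAt_cos t).sub_const 1).mul_const (v A)).const_add (u A)).add
      ((Real.hasDerivAt_sin t).mul_const (w A))
  have h := integral_deriv_eq_zero (K := K) (n := n) (k := k)
    (H := fun t A => f x₀ x₁ x₂ t A ^ a * f y₀ y₁ y₂ t A ^ b * f z₀ z₁ z₂ t A)
    (H' := fun t A => ((a * f x₀ x₁ x₂ t A ^ (a - 1) * f' x₁ x₂ t A) * f y₀ y₁ y₂ t A ^ b +
      f x₀ x₁ x₂ t A ^ a * (b * f y₀ y₁ y₂ t A ^ (b - 1) * f' y₁ y₂ t A)) * f z₀ z₁ z₂ t A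
      + f x₀ x₁ x₂ t A ^ a * f y₀ y₁ y₂ t A ^ b * f' z₁ z₂ t A)
    (fun t => by simp only [f]; fun_prop) (by simp only [f, f']; fun_prop)
    (fun t A => (((hf _ _ _ t A).pow a).mul ((hf _ _ _ t A).pow b)).mul (hf _ _ _ t A))
    (fun t => by simp only [f]; rw [hc t]; simp)
  simpa [f, f'] using h

end Deriv

section Rotation

variable {K : Type*} [NormedRing K] [StarRing K] [ContinuousStar K] [NormedAlgebra ℝ K] {n k : ℕ}
  [CompactSpace (unitaryGp K n)] [FiniteDimensional ℝ K]

/-- The integrand is the derivative of `x^a y^b z` along the vector field `A ↦ J A`, and the flow of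
this field preserves the measure. -/
theorem integral_rotation_left [StarModule ℝ K] {P J : Matrix (Fin n) (Fin n) K} (h : IsRotationPair P J)
    (x y z : Matrix (Fin n) (Fin k) K →ₗ[ℝ] ℝ) (a b : ℕ) :
    ∫ A, ((a * x A ^ (a - 1) * x (J * A)) * y A ^ b +
      x A ^ a * (b * y A ^ (b - 1) * y (J * A))) * z A + x A ^ a * y A ^ b * z (J * A)
      ∂(stiefelMeasure K n k) = 0 := by
  have hc := continuous_of_matrix_linearMap (K := K) (n := n) (k := k)
  have hm : ∀ M : Matrix (Fin n) (Fin n) K,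
      Continuous fun A : Matrix (Fin n) (Fin k) K => M * A :=
    fun M => continuous_const.matrix_mul continuous_id
  refine integral_deriv_monomial_eq_zero (x₁ := fun A => x (P * A)) (y₁ := fun A => y (P * A))
    (z₁ := fun A => z (P * A)) (hc x) ((hc x).comp (hm P)) ((hc x).comp (hm J))
    (hc y) ((hc y).comp (hm P)) ((hc y).comp (hm J))
    (hc z) ((hc z).comp (hm P)) ((hc z).comp (hm J)) a b fun t => ?_
  have hx := hc x
  have hy := hc y
  have hz := hc z
  rw [← integral_mul_left (F := fun A => x A ^ a * y A ^ b * z A) (by fun_prop) (h.mem_unitary t)]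
  simp [Matrix.add_mul]

theorem integral_rotation_right [StarModule ℝ K] (hk : k ≤ n) {P J : Matrix (Fin k) (Fin k) K}
    (h : IsRotationPair P J) (x y z : Matrix (Fin n) (Fin k) K →ₗ[ℝ] ℝ) (a b : ℕ) :
    ∫ A, ((a * x A ^ (a - 1) * x (A * J)) * y A ^ b +
      x A ^ a * (b * y A ^ (b - 1) * y (A * J))) * z A + x A ^ a * y A ^ b * z (A * J)
      ∂(stiefelMeasure K n k) = 0 := by
  have hc := continuous_of_matrix_linearMap (K := K) (n := n) (k := k)
  have hm : ∀ M : Matrix (Fin k) (Fin k) K,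
      Continuous fun A : Matrix (Fin n) (Fin k) K => A * M :=
    fun M => continuous_id.matrix_mul continuous_const
  refine integral_deriv_monomial_eq_zero (x₁ := fun A => x (A * P)) (y₁ := fun A => y (A * P))
    (z₁ := fun A => z (A * P)) (hc x) ((hc x).comp (hm P)) ((hc x).comp (hm J))
    (hc y) ((hc y).comp (hm P)) ((hc y).comp (hm J))
    (hc z) ((hc z).comp (hm P)) ((hc z).comp (hm J)) a b fun t => ?_
  have hx := hc x
  have hy := hc y
  have hz := hc z
  rw [← integral_mul_right hk (F := fun A => x A ^ a * y A ^ b * z A) (by fun_prop)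
    (h.mem_unitary t)]
  simp [Matrix.mul_add]

end Rotation

/-! ### Relations between the moments of the diagonal entries -/

section Moments

variable {K : Type*} [NormedRing K] [StarRing K] [ContinuousStar K] [NormedAlgebra ℝ K]
  {β : ℕ} [NeZero β] {e : Fin β → K} {re : K →ₗ[ℝ] ℝ}

variable {m : ℕ} [CompactSpace (unitaryGp K (m + 2))]

/-- The mixed moments of the real parts of the two diagonal entries. -/
noncomputable def moment (re : K →ₗ[ℝ] ℝ) (m : ℕ) [CompactSpace (unitaryGp K (m + 2))]
    (a b : ℕ) : ℝ :=
  ∫ A, entryRe re 1 0 0 A ^ a * entryRe re 1 1 1 A ^ b ∂(stiefelMeasure K (m + 2) 2)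

/-- An integration by parts: the rotation mixes only `x` and `T` and leaves `y` alone, so testing it
on `x^(a+1) y^b T` trades two powers of `x` for `T²`. -/
theorem moment_add_two_of_sub (S : IsScalarSystem e re) (T : Matrix (Fin (m + 2)) (Fin 2) K →ₗ[ℝ] ℝ)
    {P J : Matrix (Fin (m + 2)) (Fin (m + 2)) K} (h : IsRotationPair P J)
    (hX : ∀ A : Matrix (Fin (m + 2)) (Fin 2) K, entryRe re 1 0 0 (J * A) = -T A)
    (hY : ∀ A : Matrix (Fin (m + 2)) (Fin 2) K, entryRe re 1 1 1 (J * A) = 0)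
    (hT : ∀ A : Matrix (Fin (m + 2)) (Fin 2) K, T (J * A) = entryRe re 1 0 0 A) (a b : ℕ) :
    moment re m (a + 2) b = (a + 1) *
      ∫ A, entryRe re 1 0 0 A ^ a * entryRe re 1 1 1 A ^ b * T A ^ 2
        ∂(stiefelMeasure K (m + 2) 2) := by
  have := S.finiteDimensional
  have := S.starModule
  have hc := continuous_of_matrix_linearMap (K := K) (n := m + 2) (k := 2)
  have h1 := integral_rotation_left h (entryRe re 1 0 0) (entryRe re 1 1 1) T (a + 1) b
  simp_rw [hX, hY, hT] at h1
  have hx := hc (entryRe re 1 0 0)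
  have hy := hc (entryRe re 1 1 1)
  have ht := hc T
  rw [moment, ← integral_const_mul, ← sub_eq_zero, ← integral_sub
    (integrable_stiefelMeasure (by fun_prop)) (integrable_stiefelMeasure (by fun_prop)), ← h1]
  congr 1
  funext A
  push_cast
  ring

/-- Rotating row `0` into a row `i ≥ 2` does not touch `A₁₁`. -/
theorem moment_add_two_row (S : IsScalarSystem e re) {i : Fin (m + 2)} (h0 : i ≠ 0) (h1 : i ≠ 1)
    (c : Fin β) (a b : ℕ) :
    moment re m (a + 2) b = (a + 1) *
      ∫ A, entryRe re 1 0 0 A ^ a * entryRe re 1 1 1 A ^ b * entryRe re (star (e c)) i 0 A ^ 2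
        ∂(stiefelMeasure K (m + 2) 2) := by
  refine moment_add_two_of_sub S _
    (isRotationPair_single h0 (S.star_mul_unit c) (S.mul_star_unit c)) ?_ ?_ ?_ a b
  · intro A
    simp [single_sub_single_mul_apply h0, h0.symm]
  · intro A
    simp [single_sub_single_mul_apply h0, h1.symm]
  · intro A
    simp [single_sub_single_mul_apply h0, ← mul_assoc, S.star_mul_unit]

/-- Here the rotation multiplies row `0` by a phase generated by an imaginary unit, and so reaches
the imaginary components of `A₀₀`. -/
theorem moment_add_two_phase (S : IsScalarSystem e re) {c : Fin β} (hc : c ≠ 0) (a b : ℕ) :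
    moment re m (a + 2) b = (a + 1) *
      ∫ A, entryRe re 1 0 0 A ^ a * entryRe re 1 1 1 A ^ b * entryRe re (star (e c)) 0 0 A ^ 2
        ∂(stiefelMeasure K (m + 2) 2) := by
  refine moment_add_two_of_sub S _
    (isRotationPair_phase 0 (S.star_mul_unit c) (S.star_unit c hc)) ?_ ?_ ?_ a b
  · intro A
    simp [S.star_unit c hc]
  · intro A
    simp
  · intro A
    simp [← mul_assoc, S.star_mul_unit]

/-- The mixed moments with the square of a component of the entry in the second row. -/
noncomputable def momentSq (re : K →ₗ[ℝ] ℝ) (m : ℕ) [CompactSpace (unitaryGp K (m + 2))] (u : K)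
    (a b : ℕ) : ℝ :=
  ∫ A, entryRe re 1 0 0 A ^ a * entryRe re 1 1 1 A ^ b * entryRe re (star u) 1 0 A ^ 2
    ∂(stiefelMeasure K (m + 2) 2)

/-- The mixed moments with the product of corresponding components of the off-diagonal entries. -/
noncomputable def momentMul (re : K →ₗ[ℝ] ℝ) (m : ℕ) [CompactSpace (unitaryGp K (m + 2))] (u : K)
    (a b : ℕ) : ℝ :=
  ∫ A, entryRe re 1 0 0 A ^ a * entryRe re 1 1 1 A ^ b *
    (entryRe re u 0 1 A * entryRe re (star u) 1 0 A) ∂(stiefelMeasure K (m + 2) 2)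

/-- Infinitesimal rotation of rows `0` and `1`, tested on `x^a y^b` times a component of `A₁₀`. The
truncated exponents `a - 1`, `b - 1` occur only with a factor that vanishes at `0`. -/
theorem moment_left (S : IsScalarSystem e re) (c : Fin β) (a b : ℕ) :
    moment re m (a + 1) b =
      a * momentSq re m (e c) (a - 1) b - b * momentMul re m (e c) a (b - 1) := by
  have := S.finiteDimensional
  have := S.starModule
  have hc := continuous_of_matrix_linearMap (K := K) (n := m + 2) (k := 2)
  have h0 : (1 : Fin (m + 2)) ≠ 0 := by simp
  let J : Matrix (Fin (m + 2)) (Fin (m + 2)) K :=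
    Matrix.single 1 0 (e c) - Matrix.single 0 1 (star (e c))
  have h1 := integral_rotation_left (k := 2) (J := J)
    (isRotationPair_single h0 (S.star_mul_unit c) (S.mul_star_unit c))
    (entryRe re 1 0 0) (entryRe re 1 1 1) (entryRe re (star (e c)) 1 0) a b
  have hX : ∀ A : Matrix (Fin (m + 2)) (Fin 2) K, entryRe re 1 0 0 (J * A) =
        -entryRe re (star (e c)) 1 0 A := fun A => by simp [J, single_sub_single_mul_apply h0]
  have hY : ∀ A : Matrix (Fin (m + 2)) (Fin 2) K, entryRe re 1 1 1 (J * A) =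
        entryRe re (e c) 0 1 A := fun A => by simp [J, single_sub_single_mul_apply h0]
  have hZ : ∀ A : Matrix (Fin (m + 2)) (Fin 2) K, entryRe re (star (e c)) 1 0 (J * A) =
        entryRe re 1 0 0 A := fun A => by
    simp [J, single_sub_single_mul_apply h0, ← mul_assoc, S.star_mul_unit]
  simp_rw [hX, hY, hZ] at h1
  have hx := hc (entryRe re 1 0 0)
  have hy := hc (entryRe re 1 1 1)
  have hz := hc (entryRe re (star (e c)) 1 0)
  have hw := hc (entryRe re (e c) 0 1)
  rw [← sub_eq_zero, moment, momentSq, momentMul, ← integral_const_mul, ← integral_const_mul,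
    ← integral_sub (integrable_stiefelMeasure (by fun_prop))
      (integrable_stiefelMeasure (by fun_prop)),
    ← integral_sub (integrable_stiefelMeasure (by fun_prop))
      (integrable_stiefelMeasure (by fun_prop)), ← h1]
  congr 1
  funext A
  ring

/-- The same test function under a rotation of the two columns. The same two auxiliary moments
appear with their roles exchanged, which is what makes elimination possible. -/
theorem moment_right (S : IsScalarSystem e re) (c : Fin β) (a b : ℕ) :
    moment re m a (b + 1) =
      b * momentSq re m (e c) a (b - 1) - a * momentMul re m (e c) (a - 1) b := by
  have := S.finiteDimensional
  have := S.starModule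
  have hc := continuous_of_matrix_linearMap (K := K) (n := m + 2) (k := 2)
  have h0 : (1 : Fin 2) ≠ 0 := by simp
  let J : Matrix (Fin 2) (Fin 2) K := Matrix.single 1 0 (e c) - Matrix.single 0 1 (star (e c))
  have h1 := integral_rotation_right (n := m + 2) (J := J) (by omega)
    (isRotationPair_single h0 (S.star_mul_unit c) (S.mul_star_unit c))
    (entryRe re 1 0 0) (entryRe re 1 1 1) (entryRe re (star (e c)) 1 0) a b
  have hX : ∀ A : Matrix (Fin (m + 2)) (Fin 2) K, entryRe re 1 0 0 (A * J) =
        entryRe re (e c) 0 1 A := fun A => by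
    simp [J, mul_single_sub_single_apply h0]
    rw [S.re_mul_comm]
  have hY : ∀ A : Matrix (Fin (m + 2)) (Fin 2) K, entryRe re 1 1 1 (A * J) =
        -entryRe re (star (e c)) 1 0 A := fun A => by
    simp [J, mul_single_sub_single_apply h0]
    rw [S.re_mul_comm]
  have hZ : ∀ A : Matrix (Fin (m + 2)) (Fin 2) K, entryRe re (star (e c)) 1 0 (A * J) =
        entryRe re 1 1 1 A := fun A => by
    simp only [J, entryRe_apply, mul_single_sub_single_apply h0, if_true]
    rw [S.re_mul_comm, mul_assoc, S.mul_star_unit, mul_one, one_mul]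
  simp_rw [hX, hY, hZ] at h1
  have hx := hc (entryRe re 1 0 0)
  have hy := hc (entryRe re 1 1 1)
  have hz := hc (entryRe re (star (e c)) 1 0)
  have hw := hc (entryRe re (e c) 0 1)
  rw [← sub_eq_zero, moment, momentSq, momentMul, ← integral_const_mul, ← integral_const_mul,
    ← integral_sub (integrable_stiefelMeasure (by fun_prop))
      (integrable_stiefelMeasure (by fun_prop)),
    ← integral_sub (integrable_stiefelMeasure (by fun_prop))
      (integrable_stiefelMeasure (by fun_prop)), ← h1]
  congr 1
  funext A
  ring

/-- The mixed products can be eliminated. -/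
theorem moment_momentSq (S : IsScalarSystem e re) (c : Fin β) (a b : ℕ) :
    ((a : ℝ) + 2 - b) * moment re m (a + 2) b =
      (a + 1) * (a + 2) * momentSq re m (e c) a b -
        b * (b - 1) * momentSq re m (e c) (a + 2) (b - 2) := by
  -- `moment_left` at `(a+1, b)` and `moment_right` at `(a+2, b-1)` contain the same mixed product;
  -- it cancels with weights `a + 2` and `b`.
  have h1 := moment_left (m := m) S c (a + 1) b
  rcases b with _ | b
  · simp at h1 ⊢
    rw [h1]; ring
  · have h2 := moment_right (m := m) S c (a + 2) b
    simp only [Nat.add_sub_cancel, Nat.add_succ_sub_one, show b + 1 - 2 = b - 1 by omega] at h1 h2 ⊢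
    push_cast at h1 h2 ⊢
    linear_combination (a + 2 : ℝ) * h1 - (b + 1 : ℝ) * h2

/-- The first column of a matrix in the Stiefel manifold is a unit vector. -/
theorem moment_sphere (S : IsScalarSystem e re) (a b : ℕ) :
    (a + 1 : ℝ) * (moment re m a b - ∑ c, momentSq re m (e c) a b) =
      (a + β * (m + 1)) * moment re m (a + 2) b := by
  have := S.finiteDimensional
  have hc := continuous_of_matrix_linearMap (K := K) (n := m + 2) (k := 2)
  have hx := hc (entryRe re 1 0 0)
  have hy := hc (entryRe re 1 1 1)
  have h1 : moment re m a b = ∑ i, ∑ c,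
      ∫ A, entryRe re 1 0 0 A ^ a * entryRe re 1 1 1 A ^ b * entryRe re (star (e c)) i 0 A ^ 2
        ∂(stiefelMeasure K (m + 2) 2) := by
    have hi : ∀ (i : Fin (m + 2)) (c : Fin β), Integrable (fun A => entryRe re 1 0 0 A ^ a *
        entryRe re 1 1 1 A ^ b * entryRe re (star (e c)) i 0 A ^ 2)
        (stiefelMeasure K (m + 2) 2) := fun i c => by
      have hz := hc (entryRe re (star (e c)) i 0)
      exact integrable_stiefelMeasure (by fun_prop)
    simp_rw [← integral_finsetSum Finset.univ (fun c _ => hi _ c)]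
    rw [← integral_finsetSum Finset.univ
      (fun i _ => integrable_finsetSum Finset.univ (fun c _ => hi i c)), moment]
    refine integral_congr_ae ?_
    filter_upwards [ae_mem_stiefel (K := K) (show 2 ≤ m + 2 by omega)] with A hA
    have hA' : Aᴴ * A = 1 := hA
    have h00 := congrArg (fun M : Matrix (Fin 2) (Fin 2) K => re (M 0 0)) hA'
    simp only [Matrix.mul_apply, Matrix.conjTranspose_apply, map_sum, Matrix.one_apply_eq,
      S.re_one, S.re_star_mul_self] at h00
    simp_rw [← Finset.mul_sum]
    rw [show ∑ i, ∑ c, entryRe re (star (e c)) i 0 A ^ 2 = 1 from h00, mul_one]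
  have ha : (a + 1 : ℝ) ≠ 0 := by positivity
  have hrow : ∀ (i : Fin (m + 2)) (c : Fin β), i ≠ 0 → i ≠ 1 →
      ∫ A, entryRe re 1 0 0 A ^ a * entryRe re 1 1 1 A ^ b * entryRe re (star (e c)) i 0 A ^ 2
        ∂(stiefelMeasure K (m + 2) 2) = moment re m (a + 2) b / (a + 1) := fun i c h0 h1 => by
    rw [moment_add_two_row S h0 h1 c]; field_simp
  have hphase : ∀ c ∈ Finset.univ.erase (0 : Fin β),
      ∫ A, entryRe re 1 0 0 A ^ a * entryRe re 1 1 1 A ^ b * entryRe re (star (e c)) 0 0 A ^ 2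
        ∂(stiefelMeasure K (m + 2) 2) = moment re m (a + 2) b / (a + 1) := fun c hc => by
    rw [moment_add_two_phase S (Finset.ne_of_mem_erase hc)]; field_simp
  have hreal : ∫ A, entryRe re 1 0 0 A ^ a * entryRe re 1 1 1 A ^ b *
      entryRe re (star (e 0)) 0 0 A ^ 2 ∂(stiefelMeasure K (m + 2) 2) = moment re m (a + 2) b := by
    rw [moment]
    congr 1
    funext A
    rw [S.unit_zero, star_one]
    ring
  -- Count of the components of the first column: the real part of `A₀₀`, its `β - 1` imaginary
  -- parts, row `1` (left as `momentSq`), and `β m` components in the other rows. All but row `1`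
  -- reduce to the moment of order `(a+2, b)`.
  rw [Fin.sum_univ_succ, Fin.sum_univ_succ, ← Finset.add_sum_erase _ _ (Finset.mem_univ (0 : Fin β)),
    hreal, Finset.sum_congr rfl hphase] at h1
  have h2 : ∑ i : Fin m, ∑ c, ∫ A, entryRe re 1 0 0 A ^ a * entryRe re 1 1 1 A ^ b *
      entryRe re (star (e c)) i.succ.succ 0 A ^ 2 ∂(stiefelMeasure K (m + 2) 2) =
        m * (β * (moment re m (a + 2) b / (a + 1))) := by
    simp_rw [fun (i : Fin m) (c : Fin β) => hrow i.succ.succ c (Fin.succ_ne_zero _)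
      (fun h => Fin.succ_ne_zero i (Fin.succ_injective _ h))]
    simp
  rw [h2] at h1
  have hβ : 1 ≤ β := Nat.one_le_iff_ne_zero.2 (NeZero.ne β)
  simp only [Finset.sum_const, Finset.card_erase_of_mem (Finset.mem_univ _), Finset.card_univ,
    Fintype.card_fin, nsmul_eq_mul, Nat.cast_sub hβ, Fin.succ_zero_eq_one] at h1
  change _ = _ + (∑ c, momentSq re m (e c) a b + _) at h1
  rw [h1]
  push_cast
  field_simp
  ring

/-- The moments are symmetric, up to a sign in odd total degree. -/
theorem moment_symm (S : IsScalarSystem e re) (a b : ℕ) :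
    moment re m a b = (-1) ^ (a + b) * moment re m b a := by
  have := S.finiteDimensional
  have := S.starModule
  have hc := continuous_of_matrix_linearMap (K := K) (n := m + 2) (k := 2)
  have hx := hc (entryRe re 1 0 0)
  have hy := hc (entryRe re 1 1 1)
  have h0 : (1 : Fin (m + 2)) ≠ 0 := by simp
  have h0' : (1 : Fin 2) ≠ 0 := by simp
  -- Quarter turns of rows and columns exchange the two diagonal entries; each picks up a minus
  -- sign, whence the factor `(-1)^(a+b)`.
  obtain ⟨U, hU, hU'⟩ : ∃ U ∈ unitary (Matrix (Fin (m + 2)) (Fin (m + 2)) K),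
      U = 1 + (Real.cos (Real.pi / 2) - 1) • (Matrix.single 1 1 1 + Matrix.single 0 0 1) +
        Real.sin (Real.pi / 2) • (Matrix.single 1 0 1 - Matrix.single 0 1 (star 1)) :=
    ⟨_, (isRotationPair_single h0 (by simp) (by simp)).mem_unitary (Real.pi / 2), rfl⟩
  obtain ⟨V, hV, hV'⟩ : ∃ V ∈ unitary (Matrix (Fin 2) (Fin 2) K),
      V = 1 + (Real.cos (Real.pi / 2) - 1) • (Matrix.single 1 1 1 + Matrix.single 0 0 1) +
        Real.sin (Real.pi / 2) • (Matrix.single 1 0 1 - Matrix.single 0 1 (star 1)) :=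
    ⟨_, (isRotationPair_single h0' (by simp) (by simp)).mem_unitary (Real.pi / 2), rfl⟩
  have hF : Continuous fun A : Matrix (Fin (m + 2)) (Fin 2) K =>
      entryRe re 1 0 0 A ^ a * entryRe re 1 1 1 A ^ b := by fun_prop
  rw [moment, moment, ← integral_mul_left hF hU, ← integral_mul_right (by omega)
    (F := fun A => entryRe re 1 0 0 (U * A) ^ a * entryRe re 1 1 1 (U * A) ^ b)
    (hF.comp (continuous_const.matrix_mul continuous_id)) hV, ← integral_const_mul]
  congr 1
  funext A
  have hUA : ∀ (B : Matrix (Fin (m + 2)) (Fin 2) K) s, (U * B) 0 s = -B 1 s ∧ (U * B) 1 s = B 0 s := by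
    intro B s
    simp only [hU', Real.cos_pi_div_two, Real.sin_pi_div_two, zero_sub, one_smul, neg_smul,
      Matrix.add_mul, Matrix.add_apply, Matrix.neg_apply, Matrix.neg_mul, Matrix.one_mul,
      single_sub_single_mul_apply h0, star_one]
    simp
  have hVA : ∀ r, (A * V) r 0 = A r 1 ∧ (A * V) r 1 = -A r 0 := by
    intro r
    simp only [hV', Real.cos_pi_div_two, Real.sin_pi_div_two, zero_sub, one_smul, neg_smul,
      Matrix.mul_add, Matrix.add_apply, Matrix.neg_apply, Matrix.mul_neg, Matrix.mul_one,
      mul_single_sub_single_apply h0', star_one]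
    simp
  simp only [entryRe_apply, one_mul, (hUA _ _).1, (hUA _ _).2, (hVA _).1, (hVA _).2, map_neg]
  rw [neg_pow (re (A 1 1)), neg_pow (re (A 0 0)), pow_add]
  ring

/-- The reflection `diag(-1, 1, …, 1)` on the rows changes the sign of `A₀₀` and fixes `A₁₁`. -/
theorem moment_eq_zero_of_odd_left (S : IsScalarSystem e re) {a : ℕ} (ha : Odd a) (b : ℕ) :
    moment re m a b = 0 := by
  have := S.finiteDimensional
  have hc := continuous_of_matrix_linearMap (K := K) (n := m + 2) (k := 2)
  have hx := hc (entryRe re 1 0 0)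
  have hy := hc (entryRe re 1 1 1)
  have hU := mem_unitary_one_sub_two_mul (isSelfAdjoint_single (K := K) (0 : Fin (m + 2)))
    (by simp)
  have hF : Continuous fun A : Matrix (Fin (m + 2)) (Fin 2) K =>
      entryRe re 1 0 0 A ^ a * entryRe re 1 1 1 A ^ b := by fun_prop
  have h : moment re m a b = -moment re m a b := by
    conv_lhs => rw [moment, ← integral_mul_left hF hU]
    rw [moment, ← integral_neg]
    congr 1
    funext A
    simp only [entryRe_apply, one_mul, Matrix.sub_mul, Matrix.add_mul, Matrix.sub_apply,
      Matrix.add_apply]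
    simp [ha.neg_pow]
  linarith

theorem moment_zero_zero : moment re m 0 0 = 1 := by simp [moment]

end Moments

/-! ### The values of the moments -/

/-- The rising factorial `x (x + 1) ⋯ (x + k - 1)`. -/
noncomputable def rising (x : ℝ) (k : ℕ) : ℝ := ∏ i ∈ Finset.range k, (x + i)

@[simp] theorem rising_zero (x : ℝ) : rising x 0 = 1 := by simp [rising]

theorem rising_succ (x : ℝ) (k : ℕ) : rising x (k + 1) = rising x k * (x + k) :=
  Finset.prod_range_succ _ _

theorem rising_succ' (x : ℝ) (k : ℕ) : rising x (k + 1) = x * rising (x + 1) k := by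
  rw [rising, Finset.prod_range_succ', mul_comm, rising]
  congr 1
  · simp
  · exact Finset.prod_congr rfl fun i _ => by push_cast; ring

theorem rising_pos {x : ℝ} (hx : 0 < x) (k : ℕ) : 0 < rising x k :=
  Finset.prod_pos fun _ _ => by positivity

theorem Gamma_div_Gamma_nat_add {x : ℝ} (hx : 0 < x) (k : ℕ) :
    Real.Gamma x / Real.Gamma (k + x) = (rising x k)⁻¹ := by
  have h : Real.Gamma (k + x) = rising x k * Real.Gamma x := by
    induction k with
    | zero => simp
    | succ k ih =>
      rw [show ((k + 1 : ℕ) : ℝ) + x = (k + x) + 1 by push_cast; ring,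
        Real.Gamma_add_one (by positivity), ih, rising_succ]
      ring
  have := (Real.Gamma_pos_of_pos hx).ne'
  have := (rising_pos hx k).ne'
  rw [h]
  field_simp

/-- A form of the Chu–Vandermonde identity. -/
theorem sum_choose_mul_descFactorial_div_rising (p : ℕ) : ∀ (q : ℕ) {x : ℝ}, 0 < x →
    ∑ l ∈ Finset.range (p + 1), (p.choose l * q.descFactorial l : ℝ) / rising x l =
      rising (x + q) p / rising x p := by
  induction p with
  | zero => intro q x hx; simp
  | succ p ih =>
    intro q x hx
    have hstep : ∑ l ∈ Finset.range (p + 2),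
        ((p + 1).choose l * q.descFactorial l : ℝ) / rising x l =
        ∑ l ∈ Finset.range (p + 1), (p.choose l * q.descFactorial l : ℝ) / rising x l +
        ∑ l ∈ Finset.range (p + 1),
          (p.choose l * q.descFactorial (l + 1) : ℝ) / rising x (l + 1) := by
      rw [Finset.sum_range_succ']
      simp only [Nat.choose_succ_succ, Nat.cast_add, add_mul, add_div, Finset.sum_add_distrib]
      rw [Finset.sum_range_succ' (fun l => (p.choose l * q.descFactorial l : ℝ) / rising x l) p,
        Finset.sum_range_succ (fun l => (p.choose (l + 1) * q.descFactorial (l + 1) : ℝ) /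
          rising x (l + 1)) p]
      simp
      ring
    have hp : (x : ℝ) + p ≠ 0 := by positivity
    have h1 := (rising_pos hx p).ne'
    rw [hstep, ih q hx]
    rcases q with _ | q
    · simp [Nat.descFactorial_succ, rising_succ, h1, hp]
    -- Pascal's rule has split off a sum shifted by one in `l`. As `(q+1)` descends to `q` and `x`
    -- rises to `x + 1`, it is `(q+1)/x` times the induction hypothesis at `(q, x + 1)`; hence the
    -- induction on `p` is uniform in `q` and `x`.
    · have h2 : ∑ l ∈ Finset.range (p + 1),
          (p.choose l * (q + 1).descFactorial (l + 1) : ℝ) / rising x (l + 1) =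
          (q + 1) / x * (rising (x + 1 + q) p / rising (x + 1) p) := by
        rw [← ih q (show 0 < x + 1 by positivity), Finset.mul_sum]
        refine Finset.sum_congr rfl fun l _ => ?_
        have := (rising_pos (show 0 < x + 1 by positivity) l).ne'
        rw [Nat.succ_descFactorial_succ, rising_succ']
        push_cast
        field_simp
      have h3 : rising x p * (x + p) = x * rising (x + 1) p := by
        rw [← rising_succ, rising_succ']
      have h4 : rising (x + 1) p = rising x p * (x + p) / x := by field_simp; linarith
      rw [h2, h4, show x + 1 + (q : ℝ) = x + ((q + 1 : ℕ) : ℝ) by push_cast; ring, rising_succ,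
        rising_succ]
      push_cast
      field_simp
      ring

/-- The value of the moment of order `2p, 2q`. -/
noncomputable def momentValue (v N : ℝ) (p q : ℕ) : ℝ :=
  (2 * p).factorial * (2 * q).factorial / 4 ^ (p + q) *
    (rising v (p + q) /
      (p.factorial * q.factorial * rising v p * rising v q * rising N (p + q)))

theorem momentValue_symm (v N : ℝ) (p q : ℕ) : momentValue v N p q = momentValue v N q p := by
  simp only [momentValue, add_comm q p]
  ring

theorem momentValue_succ_zero {v N : ℝ} (hv : 0 < v) (hN : 0 < N) (p : ℕ) :
    2 * (N + p) * momentValue v N (p + 1) 0 = (2 * p + 1) * momentValue v N p 0 := by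
  have := (rising_pos hv p).ne'
  have := (rising_pos hN p).ne'
  have : v + p ≠ 0 := by positivity
  have : N + p ≠ 0 := by positivity
  simp only [momentValue, rising_succ, Nat.factorial_succ, show 2 * (p + 1) = 2 * p + 1 + 1 by ring,
    add_zero, mul_zero, rising_zero, Nat.factorial_zero, pow_succ]
  push_cast
  field_simp
  ring

/-- This is the form of `moment_recurrence` at `a = 2p`, `b = 2q + 2`, with `2v = β(m+1)` and `2(N -
v) = β`. After splitting off common rising factorials it is a rational identity. -/
theorem momentValue_recurrence {v N : ℝ} (hv : 0 < v) (hN : 0 < N) (p q : ℕ) :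
    2 * (N - v) * (2 * p - 2 * q) * momentValue v N (p + 1) (q + 1) =
      (2 * p + 2) * ((2 * p + 1) * momentValue v N p (q + 1) -
        (2 * p + 2 * v) * momentValue v N (p + 1) (q + 1)) -
      (2 * q + 2) * (2 * q + 1) * (momentValue v N (p + 1) q -
        (2 * p + 2 + 2 * v) / (2 * p + 3) * momentValue v N (p + 2) q) := by
  have := (rising_pos hv p).ne'
  have := (rising_pos hv q).ne'
  have := (rising_pos hv (p + q)).ne'
  have := (rising_pos hN (p + q)).ne'
  have : v + p ≠ 0 := by positivity
  have : v + q ≠ 0 := by positivity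
  have : v + (p + q) ≠ 0 := by positivity
  have : N + (p + q) ≠ 0 := by positivity
  have : v + (p + 1) ≠ 0 := by positivity
  have : v + (p + q + 1) ≠ 0 := by positivity
  have : N + (p + q + 1) ≠ 0 := by positivity
  simp only [momentValue, show p + 1 + (q + 1) = p + q + 1 + 1 by ring,
    show p + (q + 1) = p + q + 1 by ring, show p + 1 + q = p + q + 1 by ring,
    show p + 2 + q = p + q + 1 + 1 by ring, show 2 * (p + 1) = 2 * p + 1 + 1 by ring,
    show 2 * (q + 1) = 2 * q + 1 + 1 by ring, show 2 * (p + 2) = 2 * p + 1 + 1 + 1 + 1 by ring,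
    show p + 2 = p + 1 + 1 by ring,
    rising_succ, Nat.factorial_succ, pow_succ]
  push_cast
  field_simp
  ring

/-- The recurrences satisfied by the moments determine them. -/
theorem eq_momentValue_of_recurrence {v N : ℝ} (hv : 0 < v) (hN : v < N) {f : ℕ → ℕ → ℝ}
    (h0 : f 0 0 = 1) (hs : ∀ p q, f p q = f q p)
    (h1 : ∀ p : ℕ, 2 * (N + p) * f (p + 1) 0 = (2 * p + 1) * f p 0)
    (h2 : ∀ p q : ℕ, 2 * (N - v) * (2 * p - 2 * q) * f (p + 1) (q + 1) =
      (2 * p + 2) * ((2 * p + 1) * f p (q + 1) - (2 * p + 2 * v) * f (p + 1) (q + 1)) -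
      (2 * q + 2) * (2 * q + 1) *
        (f (p + 1) q - (2 * p + 2 + 2 * v) / (2 * p + 3) * f (p + 2) q)) :
    ∀ p q, f p q = momentValue v N p q := by
  have hN0 : 0 < N := hv.trans hN
  -- By symmetry only `q ≤ p` matters. The induction is on the total degree `j` and then on `q`: the
  -- recurrence for `(p+1, q+1)` involves lower total degree, and `(p+2, q)` of the same degree but
  -- smaller second index.
  suffices H : ∀ j q p, p + q = j → q ≤ p → f p q = momentValue v N p q by
    intro p q
    rcases le_total q p with h | h
    · exact H _ _ _ rfl h
    · rw [hs, momentValue_symm]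
      exact H _ _ _ rfl h
  intro j
  induction j with
  | zero =>
    intro q p hj _
    obtain ⟨rfl, rfl⟩ : p = 0 ∧ q = 0 := by omega
    simp [h0, momentValue]
  | succ j ihj =>
    have ihj' : ∀ p q, p + q = j → f p q = momentValue v N p q := by
      intro p q hj
      rcases le_total q p with h | h
      · exact ihj _ _ hj h
      · rw [hs, momentValue_symm]
        exact ihj _ _ (by omega) h
    intro q
    induction q with
    | zero =>
      intro p hj _
      obtain ⟨p, rfl⟩ : ∃ p', p = p' + 1 := ⟨p - 1, by omega⟩
      have hne : 2 * (N + p) ≠ 0 := by positivity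
      apply mul_left_cancel₀ hne
      rw [h1, momentValue_succ_zero hv hN0, ihj' p 0 (by omega)]
    | succ q ihq =>
      intro p hj hpq
      obtain ⟨p, rfl⟩ : ∃ p', p = p' + 1 := ⟨p - 1, by omega⟩
      have hpq' : (q : ℝ) ≤ p := by exact_mod_cast (by omega : q ≤ p)
      -- Total coefficient of the unknown `f (p+1) (q+1)` after collecting it on one side; `q ≤ p`
      -- and `v < N` make it positive.
      have hne : 2 * (N - v) * (2 * p - 2 * q) + (2 * p + 2) * (2 * p + 2 * v) ≠ 0 := by
        have : 0 ≤ 2 * (N - v) * (2 * p - 2 * q) :=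
          mul_nonneg (by linarith) (by linarith)
        positivity
      apply mul_left_cancel₀ hne
      have e1 := h2 p q
      have e2 := momentValue_recurrence hv hN0 p q
      rw [ihj' p (q + 1) (by omega), ihj' (p + 1) q (by omega),
        ihq (p + 2) (by omega) (by omega)] at e1
      linear_combination e1 - e2

/-! ### The recurrence for the moments and its solution. -/

section

variable {K : Type*} [NormedRing K] [StarRing K] [ContinuousStar K] [NormedAlgebra ℝ K]
  {β : ℕ} [NeZero β] {e : Fin β → K} {re : K →ₗ[ℝ] ℝ} {m : ℕ} [CompactSpace (unitaryGp K (m + 2))]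

/-- Summing `moment_momentSq` over the components `c` leaves only sums of `momentSq`, which
`moment_sphere` at `(a, b)` and `(a+2, b-2)` turns into moments. For `b < 2` the factor `b(b-1)`
removes the truncated terms. -/
theorem moment_recurrence (S : IsScalarSystem e re) (a b : ℕ) :
    β * ((a : ℝ) + 2 - b) * moment re m (a + 2) b =
      (a + 2) * ((a + 1) * moment re m a b - (a + β * (m + 1)) * moment re m (a + 2) b) -
      b * (b - 1) * (moment re m (a + 2) (b - 2) -
        (a + 2 + β * (m + 1)) / (a + 3) * moment re m (a + 4) (b - 2)) := by
  have h : β * (((a : ℝ) + 2 - b) * moment re m (a + 2) b) =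
      (a + 1) * (a + 2) * ∑ c, momentSq re m (e c) a b -
        b * (b - 1) * ∑ c, momentSq re m (e c) (a + 2) (b - 2) := by
    rw [Finset.mul_sum, Finset.mul_sum, ← Finset.sum_sub_distrib,
      ← Finset.sum_congr rfl fun c _ => moment_momentSq (m := m) S c a b]
    simp
  have h1 := moment_sphere (m := m) S a b
  have h2 := moment_sphere (m := m) S (a + 2) (b - 2)
  push_cast at h2
  have ha : (a : ℝ) + 3 ≠ 0 := by positivity
  rw [mul_assoc, h]
  field_simp
  linear_combination b * (b - 1) * h2 - (a + 2) * (a + 3) * h1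

theorem moment_even (S : IsScalarSystem e re) (p q : ℕ) :
    moment re m (2 * p) (2 * q) = momentValue (β * (m + 1) / 2) (β * (m + 2) / 2) p q := by
  have hβ : (0 : ℝ) < β := by exact_mod_cast Nat.pos_of_ne_zero (NeZero.ne β)
  refine eq_momentValue_of_recurrence (f := fun p q => moment re m (2 * p) (2 * q))
    (by positivity) (by linarith) moment_zero_zero ?_ ?_ ?_ p q
  · intro p q
    rw [moment_symm S]
    simp [← mul_add]
  · intro p
    have h := moment_recurrence (m := m) S (2 * p) 0
    push_cast at h
    have hp : (2 * p + 2 : ℝ) ≠ 0 := by positivity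
    apply mul_left_cancel₀ hp
    simp only [mul_add, mul_zero, mul_one]
    linear_combination h
  · intro p q
    have h := moment_recurrence (m := m) S (2 * p) (2 * q + 2)
    push_cast at h
    simp only [mul_add, mul_one] at h ⊢
    linear_combination h

end

/-! ### Reduction to diagonal matrices -/

section Reduction

variable {K : Type*} [NormedRing K] [StarRing K] [NormedAlgebra ℝ K]
  {β : ℕ} [NeZero β] {e : Fin β → K} {re : K →ₗ[ℝ] ℝ}

theorem diagonal_mem_unitary {n : ℕ} {d : Fin n → K} (h : ∀ i, star (d i) * d i = 1)
    (h' : ∀ i, d i * star (d i) = 1) :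
    Matrix.diagonal d ∈ unitary (Matrix (Fin n) (Fin n) K) := by
  rw [Unitary.mem_iff, Matrix.star_eq_conjTranspose, Matrix.diagonal_conjTranspose,
    Matrix.diagonal_mul_diagonal, Matrix.diagonal_mul_diagonal]
  simp [h, h']

/-- The Householder matrix of a nonzero vector. -/
theorem householder_mem_unitary (S : IsScalarSystem e re) {n : ℕ} (w : Fin n → K) {r : ℝ}
    (hr : r ≠ 0) (hw : ∑ i, star (w i) * w i = (2 * r) • (1 : K)) :
    1 - r⁻¹ • Matrix.of (fun i j => w i * star (w j)) ∈ unitary (Matrix (Fin n) (Fin n) K) := by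
  have hM : (Matrix.of fun i j => w i * star (w j)) * (Matrix.of fun i j => w i * star (w j)) =
      (2 * r) • (Matrix.of fun i j => w i * star (w j)) := by
    ext i j
    simp only [Matrix.mul_apply, Matrix.of_apply, Matrix.smul_apply]
    calc _ = w i * (∑ l, star (w l) * w l) * star (w j) := by
          rw [Finset.mul_sum, Finset.sum_mul]
          exact Finset.sum_congr rfl fun l _ => by simp only [mul_assoc]
      _ = _ := by rw [hw]; simp
  have hs : star (Matrix.of fun i j => w i * star (w j)) = Matrix.of fun i j => w i * star (w j) := by
    ext i j
    simp [Matrix.star_apply]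
  have := S.starModule
  have h2 : (2 * r⁻¹) • (Matrix.of fun i j => w i * star (w j)) =
      r⁻¹ • (Matrix.of fun i j => w i * star (w j)) +
        r⁻¹ • (Matrix.of fun i j => w i * star (w j)) := by rw [two_mul, add_smul]
  -- As `w` has squared norm `2r`, the matrix `(2r)⁻¹ w w†` is the projection onto its line, and `1
  -- - r⁻¹ w w†` is the reflection.
  have h := mem_unitary_one_sub_two_mul
    (P := (2 * r)⁻¹ • (Matrix.of fun i j => w i * star (w j)))
    (by rw [star_smul, hs, star_trivial]) (by
      rw [smul_mul_smul_comm, hM, smul_smul]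
      congr 1
      field_simp)
  rwa [← add_smul, show (2 * r)⁻¹ + (2 * r)⁻¹ = r⁻¹ by field_simp; norm_num] at h

/-- A vector can be rotated to a real multiple of a given basis vector, fixing the other
coordinates at which it vanishes. -/
theorem exists_unitary_mulVec (S : IsScalarSystem e re) {n : ℕ} (v : Fin n → K) (k : Fin n) :
    ∃ U ∈ unitary (Matrix (Fin n) (Fin n) K), (∃ r : ℝ, U *ᵥ v = Pi.single k (r • (1 : K))) ∧
      ∀ l, l ≠ k → v l = 0 → ∀ x, U *ᵥ Pi.single l x = Pi.single l x := by
  -- A phase first makes the `k`-th entry real. Then the inner products of the Householder vector `w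
  -- = v' - r e_k` with `v'` and with itself are the real numbers `s - r t` and `2 (s - r t)`, so
  -- noncommutativity does not interfere.
  obtain ⟨u, hu, hu', t, hut⟩ := S.exists_unit_mul (v k)
  set d : Fin n → K := Function.update 1 k u with hd
  have hdU : Matrix.diagonal d ∈ unitary (Matrix (Fin n) (Fin n) K) := by
    refine diagonal_mem_unitary (fun i => ?_) fun i => ?_ <;>
    · by_cases h : i = k
      · subst h; simp [hd, hu, hu']
      · simp [hd, h]
  set v' : Fin n → K := Matrix.diagonal d *ᵥ v with hv'
  have hv'k : v' k = t • (1 : K) := by simp [hv', Matrix.mulVec_diagonal, hd, hut]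
  have hv'l : ∀ l, l ≠ k → v' l = v l := fun l hl => by simp [hv', Matrix.mulVec_diagonal, hd, hl]
  have hdl : ∀ l, l ≠ k → ∀ x, Matrix.diagonal d *ᵥ Pi.single l x = Pi.single l x := by
    intro l hl x
    ext i
    rw [Matrix.mulVec_diagonal]
    by_cases h : i = l
    · subst h; simp [hd, hl]
    · simp [h]
  set s := ∑ i, re (star (v' i) * v' i) with hs
  have hs0 : 0 ≤ s := Finset.sum_nonneg fun i _ => S.re_star_mul_self_nonneg _
  have hsum : ∑ i, star (v' i) * v' i = s • (1 : K) := by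
    rw [hs, Finset.sum_smul]
    exact Finset.sum_congr rfl fun i _ => S.star_mul_self _
  set r := Real.sqrt s with hr
  have hrs : r * r = s := Real.mul_self_sqrt hs0
  set w : Fin n → K := v' - Pi.single k (r • (1 : K)) with hw
  have hwv : ∑ i, star (w i) * v' i = (s - r * t) • (1 : K) := by
    simp only [hw, Pi.sub_apply, star_sub, sub_mul, Finset.sum_sub_distrib, hsum]
    rw [Finset.sum_eq_single k (fun i _ hi => by simp [hi]) (by simp)]
    simp [hv'k, S.star_smul, sub_smul, smul_smul, mul_comm]
  have hww : ∑ i, star (w i) * w i = (2 * (s - r * t)) • (1 : K) := by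
    have h1 : ∑ i, star (w i) * w i =
        ∑ i, star (w i) * v' i - ∑ i, star (w i) * (Pi.single k (r • (1 : K)) : Fin n → K) i := by
      rw [← Finset.sum_sub_distrib]
      exact Finset.sum_congr rfl fun i _ => by rw [← mul_sub]; rfl
    rw [h1, hwv, Finset.sum_eq_single k (fun i _ hi => by simp [hi]) (by simp)]
    simp only [hw, Pi.sub_apply, Pi.single_eq_same, hv'k, ← sub_smul, S.star_smul, star_one,
      smul_mul_smul_comm, mul_one, ← hrs]
    congr 1
    ring
  -- In the degenerate case `w = 0`, so `v'` is already a real multiple of the basis vector and no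
  -- reflection is needed.
  by_cases h0 : s - r * t = 0
  · have hw0 : ∀ i, w i = 0 := by
      intro i
      rw [h0, mul_zero, zero_smul] at hww
      have h1 := congrArg re hww
      rw [map_sum, map_zero, Finset.sum_eq_zero_iff_of_nonneg
        fun i _ => S.re_star_mul_self_nonneg _] at h1
      exact S.eq_zero_of_re_star_mul_self (h1 i (Finset.mem_univ i))
    exact ⟨_, hdU, ⟨r, sub_eq_zero.1 (funext hw0)⟩, fun l hl _ => hdl l hl⟩
  · have hH := householder_mem_unitary S w h0 hww
    refine ⟨_, mul_mem hH hdU, ⟨r, ?_⟩, fun l hl hvl x => ?_⟩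
    · rw [← Matrix.mulVec_mulVec, ← hv', Matrix.sub_mulVec, Matrix.one_mulVec]
      have : ((s - r * t)⁻¹ • Matrix.of fun i j => w i * star (w j)) *ᵥ v' = w := by
        ext i
        rw [Matrix.smul_mulVec, Pi.smul_apply, Matrix.mulVec, dotProduct]
        simp only [Matrix.of_apply, mul_assoc]
        rw [← Finset.mul_sum, hwv, mul_smul_comm, mul_one, smul_smul, inv_mul_cancel₀ h0, one_smul]
      rw [this, hw, sub_sub_cancel]
    · rw [← Matrix.mulVec_mulVec, hdl l hl, Matrix.sub_mulVec, Matrix.one_mulVec]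
      have hwl : w l = 0 := by simp [hw, hv'l l hl, hvl, hl]
      have : ((s - r * t)⁻¹ • Matrix.of fun i j => w i * star (w j)) *ᵥ Pi.single l x = 0 := by
        ext i
        rw [Matrix.smul_mulVec, Pi.smul_apply]
        simp [hwl]
      rw [this, sub_zero]

/-- The matrix with real diagonal entries `s`, `t`. -/
noncomputable def diagTwo (K : Type*) [NormedRing K] [NormedAlgebra ℝ K] (m : ℕ) (s t : ℝ) :
    Matrix (Fin (m + 2)) (Fin 2) K :=
  Matrix.single 0 0 (s • (1 : K)) + Matrix.single 1 1 (t • (1 : K))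

/-- In double angles the equation reads `(a/2) sin 2t + b cos 2t = 0`, so `2t` can be the argument
of `a - 2bi`. -/
theorem exists_cos_sin_orthogonal (a b : ℝ) :
    ∃ t : ℝ, a * (Real.cos t * Real.sin t) + b * (Real.cos t ^ 2 - Real.sin t ^ 2) = 0 := by
  set z : ℂ := ⟨a, -2 * b⟩ with hz
  have h1 : ‖z‖ * Real.cos z.arg = a := Complex.norm_mul_cos_arg z
  have h2 : ‖z‖ * Real.sin z.arg = -2 * b := Complex.norm_mul_sin_arg z
  refine ⟨z.arg / 2, ?_⟩
  have h3 : Real.sin z.arg = 2 * Real.sin (z.arg / 2) * Real.cos (z.arg / 2) := by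
    rw [← Real.sin_two_mul]; congr 1; ring
  have h4 : Real.cos z.arg = Real.cos (z.arg / 2) ^ 2 - Real.sin (z.arg / 2) ^ 2 := by
    rw [← Real.cos_two_mul']; congr 1; ring
  rw [h4] at h1
  rw [h3] at h2
  generalize Real.cos (z.arg / 2) = c at *
  generalize Real.sin (z.arg / 2) = s at *
  have hb : b = -(‖z‖ * s * c) := by linarith
  rw [← h1, hb]
  ring

theorem exists_plane_rotation (S : IsScalarSystem e re) {n : ℕ} (t : ℝ) :
    ∃ V ∈ unitary (Matrix (Fin 2) (Fin 2) K),
      (∀ (B : Matrix (Fin n) (Fin 2) K) i, (B * V) i 0 = Real.cos t • B i 0 + Real.sin t • B i 1) ∧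
      ∀ (B : Matrix (Fin n) (Fin 2) K) i, (B * V) i 1 = Real.cos t • B i 1 - Real.sin t • B i 0 := by
  have := S.starModule
  have h10 : (1 : Fin 2) ≠ 0 := by simp
  refine ⟨_, (isRotationPair_single (K := K) h10 (u := 1) (by simp) (by simp)).mem_unitary t,
    fun B i => ?_, fun B i => ?_⟩ <;>
  · simp only [Matrix.mul_add, Matrix.mul_one, Matrix.add_apply, Matrix.mul_smul,
      Matrix.smul_apply, mul_single_sub_single_apply h10]
    simp
    module

variable {m : ℕ}

/-- Singular value decomposition: a property of matrices with two columns which is invariant under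
unitary transformations of the rows and of the columns holds if it holds for real diagonal
matrices. -/
theorem matrix_two_columns_induction (S : IsScalarSystem e re)
    {p : Matrix (Fin (m + 2)) (Fin 2) K → Prop}
    (hl : ∀ U ∈ unitary (Matrix (Fin (m + 2)) (Fin (m + 2)) K), ∀ B, p (U * B) → p B)
    (hr : ∀ V ∈ unitary (Matrix (Fin 2) (Fin 2) K), ∀ B, p (B * V) → p B)
    (hd : ∀ s t, p (diagTwo K m s t)) (B : Matrix (Fin (m + 2)) (Fin 2) K) : p B := by
  have := S.starModule
  have h10 : (1 : Fin 2) ≠ 0 := by simp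
  have h10' : (1 : Fin (m + 2)) ≠ 0 := by simp
  have hrot := fun t => exists_plane_rotation (n := m + 2) S t
  choose R hrot hR0 hR1 using hrot
  -- nonzero first column, orthogonal columns
  have key : ∀ B : Matrix (Fin (m + 2)) (Fin 2) K, (∃ i, B i 0 ≠ 0) →
      ∑ i, star (B i 0) * B i 1 = 0 → p B := by
    intro B ⟨i₀, hi₀⟩ horth
    obtain ⟨U, hU, ⟨s, hs⟩, -⟩ := exists_unitary_mulVec S (fun i => B i 0) 0
    refine hl U hU B ?_
    have hU1 : star U * U = 1 := (Unitary.mem_iff.1 hU).1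
    have hB : (U * B)ᴴ * (U * B) = Bᴴ * B := by
      rw [Matrix.conjTranspose_mul, Matrix.mul_assoc, ← Matrix.mul_assoc Uᴴ,
        ← Matrix.star_eq_conjTranspose U, hU1, Matrix.one_mul]
    have hcol : ∀ i, (U * B) i 0 = (Pi.single 0 (s • (1 : K)) : Fin (m + 2) → K) i :=
      fun i => congrFun hs i
    have hs0 : s ≠ 0 := by
      rintro rfl
      apply hi₀
      have h1 := congrArg (fun M : Matrix (Fin (m + 2)) (Fin 2) K => M i₀ 0)
        (show star U * (U * B) = B by rw [← Matrix.mul_assoc, hU1, Matrix.one_mul])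
      simp only [Matrix.mul_apply (M := star U), hcol] at h1
      rw [← h1]
      simp
    -- The first column is now `s e₀` with `s ≠ 0`, so orthogonality kills the top entry of the
    -- second. Hence the unitary `W` that moves the second column to `e₁` can fix `e₀`.
    have h01 : (U * B) 0 1 = 0 := by
      have h1 := congrArg (fun M : Matrix (Fin 2) (Fin 2) K => M 0 1) hB
      simp only [Matrix.mul_apply (M := (U * B)ᴴ), Matrix.mul_apply (M := Bᴴ),
        Matrix.conjTranspose_apply, hcol, horth] at h1
      rw [Finset.sum_eq_single 0 (fun i _ hi => by simp [hi]) (by simp)] at h1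
      simpa [S.star_smul, hs0] using h1
    set C := U * B with hC
    obtain ⟨W, hW, ⟨t, ht⟩, hfix⟩ := exists_unitary_mulVec S (fun i => C i 1) 1
    refine hl W hW C ?_
    have hfin : W * C = diagTwo K m s t := by
      ext i j
      fin_cases j
      · have h1 : (W * C) i 0 = (W *ᵥ fun i => C i 0) i := rfl
        have h2 : (fun i => C i 0) = Pi.single 0 (s • (1 : K)) := funext hcol
        simp only [Fin.zero_eta]
        rw [h1, h2, hfix 0 h10'.symm h01]
        by_cases hi : i = 0
        · subst hi; simp [diagTwo]
        · simp [diagTwo, hi, Ne.symm hi]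
      · have h1 : (W * C) i 1 = (W *ᵥ fun i => C i 1) i := rfl
        simp only [Fin.mk_one]
        rw [h1, ht]
        by_cases hi : i = 1
        · subst hi; simp [diagTwo]
        · simp [diagTwo, hi, Ne.symm hi]
    rw [hfin]
    exact hd s t
  -- orthogonal columns
  have key2 : ∀ B : Matrix (Fin (m + 2)) (Fin 2) K,
      ∑ i, star (B i 0) * B i 1 = 0 → p B := by
    intro B horth
    by_cases h0 : ∃ i, B i 0 ≠ 0
    · exact key B h0 horth
    push Not at h0
    by_cases h1 : ∃ i, B i 1 ≠ 0
    · refine hr _ (hrot (Real.pi / 2)) B (key _ ?_ ?_)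
      · obtain ⟨i, hi⟩ := h1
        exact ⟨i, by rw [hR0]; simpa [h0] using hi⟩
      · simp only [hR0, hR1]
        simp [h0]
    · push Not at h1
      have : B = diagTwo K m 0 0 := by
        ext i j
        fin_cases j <;> simp [diagTwo, h0, h1]
      rw [this]
      exact hd 0 0
  -- real inner product of the columns
  have key3 : ∀ (B : Matrix (Fin (m + 2)) (Fin 2) K) (q : ℝ),
      ∑ i, star (B i 0) * B i 1 = q • (1 : K) → p B := by
    intro B q hq
    have hq' : ∑ i, star (B i 1) * B i 0 = q • (1 : K) := by
      have := congrArg star hq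
      simpa [S.star_smul] using this
    have hnorm : ∀ j, ∃ x : ℝ, ∑ i, star (B i j) * B i j = x • (1 : K) := fun j =>
      ⟨∑ i, re (star (B i j) * B i j), by
        rw [Finset.sum_smul]; exact Finset.sum_congr rfl fun i _ => S.star_mul_self _⟩
    obtain ⟨x, hx⟩ := hnorm 0
    obtain ⟨y, hy⟩ := hnorm 1
    -- After a plane rotation by `t` the inner product of the columns is the displayed trigonometric
    -- form with coefficients `y - x` and `q`.
    obtain ⟨t, ht⟩ := exists_cos_sin_orthogonal (y - x) q
    refine hr _ (hrot t) B (key2 _ ?_)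
    simp only [hR0, hR1, star_add, S.star_smul, add_mul, mul_sub, smul_mul_smul_comm,
      Finset.sum_add_distrib, Finset.sum_sub_distrib, ← Finset.smul_sum, hx, hy, hq, hq']
    simp only [smul_smul, ← sub_smul, ← add_smul]
    rw [← zero_smul ℝ (1 : K), ← ht]
    congr 1
    ring
  -- Multiplying the second column by the phase `star u` makes the inner product of the columns
  -- real.
  obtain ⟨u, hu, hu', t, hut⟩ := S.exists_unit_mul (star (∑ i, star (B i 0) * B i 1))
  refine hr (Matrix.diagonal ![1, star u])
    (diagonal_mem_unitary (by simp [Fin.forall_fin_two, hu'])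
      (by simp [Fin.forall_fin_two, hu])) B (key3 _ t ?_)
  simp only [Matrix.mul_diagonal]
  have h := congrArg star hut
  rw [star_mul, star_star, S.star_smul, star_one, Finset.sum_mul] at h
  rw [← h]
  simp [mul_assoc]

end Reduction

/-! ### The integral of a power of a linear form -/

section Sums

theorem sum_range_two_mul_add_one {g : ℕ → ℝ} (hg : ∀ i, Odd i → g i = 0) (j : ℕ) :
    ∑ i ∈ Finset.range (2 * j + 1), g i = ∑ p ∈ Finset.range (j + 1), g (2 * p) := by
  induction j with
  | zero => simp
  | succ j ih =>
    rw [show 2 * (j + 1) + 1 = 2 * j + 1 + 1 + 1 by ring, Finset.sum_range_succ,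
      Finset.sum_range_succ, ih, Finset.sum_range_succ _ (j + 1), hg (2 * j + 1) ⟨j, rfl⟩, add_zero]
    rfl

/-- The Chu–Vandermonde identity at `x = v`, divided by `p! q!`. Extending the sum over `l ≤ p` or
cutting it at `(p+q)/2` changes nothing, since only `l ≤ min p q` contributes. -/
theorem sum_choose_div_factorial {v : ℝ} (hv : 0 < v) (p q : ℕ) :
    ∑ l ∈ Finset.range ((p + q) / 2 + 1), (if l ≤ p ∧ l ≤ q then
      (rising v l * l.factorial * (p - l).factorial * (q - l).factorial : ℝ)⁻¹ else 0) =
      rising v (p + q) / (p.factorial * q.factorial * rising v p * rising v q) := by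
  have hr := fun k => (rising_pos hv k).ne'
  have hadd : rising v (p + q) = rising v q * rising (v + q) p := by
    rw [rising, rising, rising, add_comm p q, Finset.prod_range_add]
    congr 1
    exact Finset.prod_congr rfl fun i _ => by push_cast; ring
  have h := sum_choose_mul_descFactorial_div_rising p q hv
  have h1 : rising v (p + q) / (p.factorial * q.factorial * rising v p * rising v q) =
      (rising (v + q) p / rising v p) / (p.factorial * q.factorial) := by
    rw [hadd]
    have := hr p
    have := hr q
    field_simp
  rw [h1, ← h, Finset.sum_div, ← Finset.sum_filter]
  symm
  rw [← Finset.sum_filter_add_sum_filter_not _ (fun l => l ≤ q)]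
  rw [Finset.sum_eq_zero (s := Finset.filter (fun l => ¬ l ≤ q) _), add_zero]
  · refine Finset.sum_congr ?_ fun l hl => ?_
    · ext l
      simp only [Finset.mem_filter, Finset.mem_range]
      omega
    · have hl' : l ≤ p ∧ l ≤ q := (Finset.mem_filter.1 hl).2
      have e1 : (p.choose l * l.factorial * (p - l).factorial : ℝ) = p.factorial := by
        exact_mod_cast Nat.choose_mul_factorial_mul_factorial hl'.1
      have e2 : ((q - l).factorial * q.descFactorial l : ℝ) = q.factorial := by
        exact_mod_cast Nat.factorial_mul_descFactorial hl'.2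
      have := hr l
      have h3 : (p.factorial : ℝ) ≠ 0 := by positivity
      have h4 : (q.factorial : ℝ) ≠ 0 := by positivity
      field_simp
      rw [← e1, ← e2]
      ring
  · intro l hl
    have hl' : q < l := not_le.1 (Finset.mem_filter.1 hl).2
    simp [Nat.descFactorial_eq_zero_iff_lt.2 hl']

/-- Expanding `(x+y)^(j-2l)` and shifting its index by `l`, the coefficient of `x^p y^(j-p)` is the
sum evaluated in `sum_choose_div_factorial`. -/
theorem sum_mul_add_pow_mul_pow {v : ℝ} (hv : 0 < v) (x y : ℝ) (j : ℕ) :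
    ∑ l ∈ Finset.range (j / 2 + 1), (rising v l)⁻¹ *
      ((x + y) ^ (j - 2 * l) * (x * y) ^ l / ((j - 2 * l).factorial * l.factorial)) =
    ∑ p ∈ Finset.range (j + 1), rising v j /
      (p.factorial * (j - p).factorial * rising v p * rising v (j - p)) * (x ^ p * y ^ (j - p)) := by
  have h1 : ∀ p ∈ Finset.range (j + 1), rising v j /
      (p.factorial * (j - p).factorial * rising v p * rising v (j - p)) * (x ^ p * y ^ (j - p)) =
      ∑ l ∈ Finset.range (j / 2 + 1), (if l ≤ p ∧ l ≤ j - p then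
        (rising v l * l.factorial * (p - l).factorial * (j - p - l).factorial : ℝ)⁻¹ else 0) *
          (x ^ p * y ^ (j - p)) := by
    intro p hp
    have hp' : p + (j - p) = j := by have := Finset.mem_range.1 hp; omega
    rw [← Finset.sum_mul]
    congr 1
    have h := sum_choose_div_factorial hv p (j - p)
    rw [hp'] at h
    exact h.symm
  rw [Finset.sum_congr rfl h1, Finset.sum_comm]
  refine Finset.sum_congr rfl fun l hl => ?_
  have hl' : 2 * l ≤ j := by have := Finset.mem_range.1 hl; omega
  simp_rw [ite_mul, zero_mul]
  rw [← Finset.sum_filter, add_pow, Finset.sum_mul, Finset.sum_div, Finset.mul_sum]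
  refine Finset.sum_bij' (fun i _ => i + l) (fun p _ => p - l) ?_ ?_ ?_ ?_ ?_
  · intro i hi
    simp only [Finset.mem_filter, Finset.mem_range] at hi ⊢
    omega
  · intro p hp
    simp only [Finset.mem_filter, Finset.mem_range] at hp ⊢
    omega
  · intro i hi
    simp
  · intro p hp
    simp only [Finset.mem_filter, Finset.mem_range] at hp
    omega
  · intro i hi
    have hi' : i ≤ j - 2 * l := by have := Finset.mem_range.1 hi; omega
    have e1 : ((j - 2 * l).choose i * i.factorial * (j - 2 * l - i).factorial : ℝ) =
        (j - 2 * l).factorial := by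
      exact_mod_cast Nat.choose_mul_factorial_mul_factorial hi'
    have e2 : j - (i + l) - l = j - 2 * l - i := by omega
    have e3 : j - (i + l) = j - 2 * l - i + l := by omega
    have := (rising_pos hv l).ne'
    have h3 : ((j - 2 * l).factorial : ℝ) ≠ 0 := by positivity
    rw [e2, e3, Nat.add_sub_cancel, mul_pow, pow_add, pow_add]
    field_simp
    rw [← e1]
    ring

end Sums

/-! ### Invariants of the Gram matrix and even powers of a linear form. -/

section Core

variable {K : Type*} [NormedRing K] [StarRing K] [NormedAlgebra ℝ K]
  {β : ℕ} [NeZero β] {e : Fin β → K} {re : K →ₗ[ℝ] ℝ}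

/-- Over the quaternions the trace itself is not cyclic; its real part is. For this reason the
invariants are built from real parts of traces of powers. -/
theorem re_trace_mul_comm (S : IsScalarSystem e re) {n k : ℕ} (M : Matrix (Fin n) (Fin k) K)
    (N : Matrix (Fin k) (Fin n) K) : re (M * N).trace = re (N * M).trace := by
  simp only [Matrix.trace, Matrix.diag_apply, Matrix.mul_apply, map_sum]
  rw [Finset.sum_comm]
  exact Finset.sum_congr rfl fun i _ => Finset.sum_congr rfl fun j _ => S.re_mul_comm _ _

/-- The first invariant of a matrix, the trace of `Bᴴ * B`. -/
noncomputable def gramTrace (re : K →ₗ[ℝ] ℝ) {n k : ℕ} (B : Matrix (Fin n) (Fin k) K) : ℝ :=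
  re (Bᴴ * B).trace

/-- The second elementary symmetric function of the squares of the singular values of a matrix. -/
noncomputable def gramDet (re : K →ₗ[ℝ] ℝ) {n k : ℕ} (B : Matrix (Fin n) (Fin k) K) : ℝ :=
  ((re (Bᴴ * B).trace) ^ 2 - re ((Bᴴ * B) * (Bᴴ * B)).trace) / 2

theorem gram_mul_left {n k : ℕ} {U : Matrix (Fin n) (Fin n) K}
    (hU : U ∈ unitary (Matrix (Fin n) (Fin n) K)) (A B : Matrix (Fin n) (Fin k) K) :
    (U * A)ᴴ * (U * B) = Aᴴ * B := by
  rw [Matrix.conjTranspose_mul, Matrix.mul_assoc, ← Matrix.mul_assoc Uᴴ,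
    ← Matrix.star_eq_conjTranspose U, (Unitary.mem_iff.1 hU).1, Matrix.one_mul]

theorem gram_mul_right {n k : ℕ} (V : Matrix (Fin k) (Fin k) K) (A B : Matrix (Fin n) (Fin k) K) :
    (A * V)ᴴ * (B * V) = Vᴴ * (Aᴴ * B * V) := by
  rw [Matrix.conjTranspose_mul]
  simp only [Matrix.mul_assoc]

theorem re_trace_gram_mul_right (S : IsScalarSystem e re) {n k : ℕ} {V : Matrix (Fin k) (Fin k) K}
    (hV : V ∈ unitary (Matrix (Fin k) (Fin k) K)) (A B : Matrix (Fin n) (Fin k) K) :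
    re ((A * V)ᴴ * (B * V)).trace = re (Aᴴ * B).trace := by
  have h : V * Vᴴ = 1 := (Unitary.mem_iff.1 hV).2
  rw [gram_mul_right, re_trace_mul_comm S, Matrix.mul_assoc, h, Matrix.mul_one]

theorem gramDet_mul_right (S : IsScalarSystem e re) {n k : ℕ} {V : Matrix (Fin k) (Fin k) K}
    (hV : V ∈ unitary (Matrix (Fin k) (Fin k) K)) (B : Matrix (Fin n) (Fin k) K) :
    gramDet re (B * V) = gramDet re B := by
  have h : V * Vᴴ = 1 := (Unitary.mem_iff.1 hV).2
  rw [gramDet, gramDet, re_trace_gram_mul_right S hV, gram_mul_right]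
  congr 2
  rw [Matrix.mul_assoc Vᴴ, re_trace_mul_comm S]
  congr 2
  calc _ = Bᴴ * B * (V * Vᴴ) * (Bᴴ * B) * (V * Vᴴ) := by simp only [Matrix.mul_assoc]
    _ = _ := by rw [h, Matrix.mul_one, Matrix.mul_one]

variable {m : ℕ}

theorem gram_diagTwo (S : IsScalarSystem e re) (s t : ℝ) :
    (diagTwo K m s t)ᴴ * diagTwo K m s t =
      Matrix.single 0 0 ((s ^ 2) • (1 : K)) + Matrix.single 1 1 ((t ^ 2) • (1 : K)) := by
  simp [diagTwo, Matrix.add_mul, Matrix.mul_add, S.star_smul, smul_smul, sq]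

theorem gramTrace_diagTwo (S : IsScalarSystem e re) (s t : ℝ) :
    gramTrace re (diagTwo K m s t) = s ^ 2 + t ^ 2 := by
  rw [gramTrace, gram_diagTwo S]
  simp [Matrix.trace_add, S.re_one]

theorem gramDet_diagTwo (S : IsScalarSystem e re) (s t : ℝ) :
    gramDet re (diagTwo K m s t) = s ^ 2 * t ^ 2 := by
  rw [gramDet, gram_diagTwo S]
  simp [Matrix.trace_add, S.re_one, Matrix.add_mul, Matrix.mul_add]
  ring

variable [ContinuousStar K] [CompactSpace (unitaryGp K (m + 2))]

theorem continuous_re_trace_gram (S : IsScalarSystem e re) {n k : ℕ}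
    (B : Matrix (Fin n) (Fin k) K) :
    Continuous fun A : Matrix (Fin n) (Fin k) K => re (Aᴴ * B).trace := by
  have := S.finiteDimensional
  have h : Continuous re := re.continuous_of_finiteDimensional
  exact h.comp ((continuous_id.matrix_conjTranspose.matrix_mul continuous_const).matrix_trace)

theorem integral_diagTwo (S : IsScalarSystem e re) (s t : ℝ) (j : ℕ) :
    ∫ A, re (Aᴴ * diagTwo K m s t).trace ^ (2 * j) ∂(stiefelMeasure K (m + 2) 2) =
      (2 * j).factorial * (4 ^ j * rising (β * (m + 2) / 2) j)⁻¹ *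
        ∑ l ∈ Finset.range (j / 2 + 1), (rising (β * (m + 1) / 2) l)⁻¹ *
          ((s ^ 2 + t ^ 2) ^ (j - 2 * l) * (s ^ 2 * t ^ 2) ^ l /
            ((j - 2 * l).factorial * l.factorial)) := by
  have := S.finiteDimensional
  have hβ : (0 : ℝ) < β := by exact_mod_cast Nat.pos_of_ne_zero (NeZero.ne β)
  have hc := continuous_of_matrix_linearMap (K := K) (n := m + 2) (k := 2)
  have hx := hc (entryRe re 1 0 0)
  have hy := hc (entryRe re 1 1 1)
  have h1 : ∀ A : Matrix (Fin (m + 2)) (Fin 2) K, re (Aᴴ * diagTwo K m s t).trace =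
      s * entryRe re 1 0 0 A + t * entryRe re 1 1 1 A := by
    intro A
    simp [diagTwo, Matrix.mul_add, Matrix.trace_add, Matrix.trace_mul_single, S.re_star]
  rw [sum_mul_add_pow_mul_pow (by positivity), Finset.mul_sum]
  simp_rw [h1, add_pow]
  rw [integral_finsetSum _ fun i _ => integrable_stiefelMeasure (by fun_prop)]
  have h2 : ∀ i, ∫ A, (s * entryRe re 1 0 0 A) ^ i * (t * entryRe re 1 1 1 A) ^ (2 * j - i) *
      ((2 * j).choose i : ℝ) ∂(stiefelMeasure K (m + 2) 2) =
      (2 * j).choose i * (s ^ i * t ^ (2 * j - i)) * moment re m i (2 * j - i) := by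
    intro i
    rw [moment, ← integral_const_mul]
    congr 1
    funext A
    ring
  simp_rw [h2]
  rw [sum_range_two_mul_add_one fun i hi => by rw [moment_eq_zero_of_odd_left S hi, mul_zero]]
  refine Finset.sum_congr rfl fun p hp => ?_
  have hp' : p ≤ j := by have := Finset.mem_range.1 hp; omega
  have hj : 2 * j - 2 * p = 2 * (j - p) := by omega
  have e1 : ((2 * j).choose (2 * p) * (2 * p).factorial * (2 * (j - p)).factorial : ℝ) =
      (2 * j).factorial := by
    rw [← hj]
    exact_mod_cast Nat.choose_mul_factorial_mul_factorial (by omega : 2 * p ≤ 2 * j)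
  rw [hj, moment_even S, momentValue, show p + (j - p) = j by omega, ← e1]
  have h3 := (rising_pos (show (0 : ℝ) < β * (m + 2) / 2 by positivity) j).ne'
  have h4 := (rising_pos (show (0 : ℝ) < β * (m + 1) / 2 by positivity) p).ne'
  have h5 := (rising_pos (show (0 : ℝ) < β * (m + 1) / 2 by positivity) (j - p)).ne'
  generalize rising (β * (m + 2) / 2 : ℝ) j = a at *
  generalize rising (β * (m + 1) / 2 : ℝ) p = b at *
  generalize rising (β * (m + 1) / 2 : ℝ) (j - p) = c at *
  generalize rising (β * (m + 1) / 2 : ℝ) j = d at *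
  field_simp
  rw [← pow_mul, ← pow_mul]
  ring

/-- The integral over the Stiefel manifold of an even power of a linear form. -/
theorem integral_re_trace_pow (S : IsScalarSystem e re) (B : Matrix (Fin (m + 2)) (Fin 2) K)
    (j : ℕ) :
    ∫ A, re (Aᴴ * B).trace ^ (2 * j) ∂(stiefelMeasure K (m + 2) 2) =
      (2 * j).factorial * (4 ^ j * rising (β * (m + 2) / 2) j)⁻¹ *
        ∑ l ∈ Finset.range (j / 2 + 1), (rising (β * (m + 1) / 2) l)⁻¹ *
          (gramTrace re B ^ (j - 2 * l) * gramDet re B ^ l /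
            ((j - 2 * l).factorial * l.factorial)) := by
  refine matrix_two_columns_induction S (p := fun B => ∫ A, re (Aᴴ * B).trace ^ (2 * j)
    ∂(stiefelMeasure K (m + 2) 2) = (2 * j).factorial * (4 ^ j * rising (β * (m + 2) / 2) j)⁻¹ *
        ∑ l ∈ Finset.range (j / 2 + 1), (rising (β * (m + 1) / 2) l)⁻¹ *
          (gramTrace re B ^ (j - 2 * l) * gramDet re B ^ l /
            ((j - 2 * l).factorial * l.factorial))) ?_ ?_ ?_ B
  · intro U hU B h
    have hc : Continuous fun A : Matrix (Fin (m + 2)) (Fin 2) K => re (Aᴴ * (U * B)).trace ^ (2 * j) :=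
      (continuous_re_trace_gram S _).pow _
    rw [← integral_mul_left hc hU] at h
    simpa only [gramTrace, gramDet, gram_mul_left hU] using h
  · intro V hV B h
    have hc : Continuous fun A : Matrix (Fin (m + 2)) (Fin 2) K => re (Aᴴ * (B * V)).trace ^ (2 * j) :=
      (continuous_re_trace_gram S _).pow _
    rw [← integral_mul_right (by omega) hc hV, gramDet_mul_right S hV] at h
    simpa only [gramTrace, re_trace_gram_mul_right S hV] using h
  · intro s t
    simp only [gramTrace_diagTwo S, gramDet_diagTwo S]
    exact integral_diagTwo S s t j

end Core

/-! ### Iterated derivatives and differential operators with constant coefficients -/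

section Symmetry

variable {E F ι : Type*} [NormedAddCommGroup E] [NormedSpace ℝ E] [NormedAddCommGroup F]
  [NormedSpace ℝ F]

/-- The iterated derivative of `f` along the directions `g i`, for `i` in a list. -/
noncomputable def listDeriv (g : ι → E) (f : E → F) (l : List ι) (x : E) : F :=
  iteratedFDeriv ℝ l.length f x fun i => g (l.get i)

theorem contDiffAt_listDeriv (g : ι → E) {f : E → F} {x : E} (hf : ContDiffAt ℝ ∞ f x)
    (l : List ι) : ContDiffAt ℝ ∞ (listDeriv g f l) x := by
  have h : ContDiffAt ℝ ∞ (iteratedFDeriv ℝ l.length f) x :=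
    hf.iteratedFDeriv_right (m := ∞) (by exact_mod_cast le_top)
  exact (ContinuousMultilinearMap.apply ℝ (fun _ : Fin l.length => E) F
    fun i => g (l.get i)).contDiff.contDiffAt.comp x h

theorem listDeriv_cons (g : ι → E) {f : E → F} {x : E} (hf : ContDiffAt ℝ ∞ f x) (a : ι)
    (l : List ι) : listDeriv g f (a :: l) x = fderiv ℝ (listDeriv g f l) x (g a) := by
  have h : DifferentiableAt ℝ (iteratedFDeriv ℝ l.length f) x :=
    hf.differentiableAt_iteratedFDeriv (by exact_mod_cast ENat.natCast_lt_top _)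
  exact h.iteratedFDeriv_succ_apply_left'

theorem listDeriv_perm (g : ι → E) {f : E → F} {Ω : Set E} (hΩ : IsOpen Ω)
    (hf : ContDiffOn ℝ ∞ f Ω) {l₁ l₂ : List ι} (h : l₁.Perm l₂) :
    ∀ x ∈ Ω, listDeriv g f l₁ x = listDeriv g f l₂ x := by
  have hfx : ∀ x ∈ Ω, ContDiffAt ℝ ∞ f x := fun x hx => hf.contDiffAt (hΩ.mem_nhds hx)
  induction h with
  | nil => exact fun x _ => rfl
  -- The permuted derivatives must agree in a neighbourhood before they can be differentiated once
  -- more, so the induction runs over all points of `Ω`.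
  | @cons a l₁ l₂ _ ih =>
    intro x hx
    have he : listDeriv g f l₁ =ᶠ[𝓝 x] listDeriv g f l₂ := by
      filter_upwards [hΩ.mem_nhds hx] with y hy using ih y hy
    rw [listDeriv_cons g (hfx x hx), listDeriv_cons g (hfx x hx), he.fderiv_eq]
  | swap a b l =>
    intro x hx
    have hc := contDiffAt_listDeriv g (hfx x hx) l
    have hle : (2 : WithTop ℕ∞) ≤ ∞ := WithTop.coe_le_coe.2 (le_top : (2 : ℕ∞) ≤ ⊤)
    have hd : DifferentiableAt ℝ (fderiv ℝ (listDeriv g f l)) x :=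
      (hc.fderiv_right (m := 1) (by simpa [one_add_one_eq_two] using hle)).differentiableAt
        one_ne_zero
    have h2 : ∀ c d : ι, listDeriv g f (c :: d :: l) x =
        fderiv ℝ (fderiv ℝ (listDeriv g f l)) x (g c) (g d) := by
      intro c d
      have he : listDeriv g f (d :: l) =ᶠ[𝓝 x] fun y => fderiv ℝ (listDeriv g f l) y (g d) := by
        filter_upwards [hΩ.mem_nhds hx] with y hy using listDeriv_cons g (hfx y hy) d l
      rw [listDeriv_cons g (hfx x hx), he.fderiv_eq, fderiv_clm_apply hd (by fun_prop)]
      simp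
    rw [h2, h2]
    exact (hc.isSymmSndFDerivAt (by simpa using hle)).eq _ _
  | trans _ _ ih₁ ih₂ => exact fun x hx => (ih₁ x hx).trans (ih₂ x hx)

theorem listDeriv_ofFn (g : ι → E) (f : E → F) (x : E) {d : ℕ} (k : Fin d → ι) :
    listDeriv g f (List.ofFn k) x = iteratedFDeriv ℝ d f x fun i => g (k i) := by
  have h : ∀ (l : List ι) (hl : l.length = d),
      listDeriv g f l x = iteratedFDeriv ℝ d f x fun i => g (l.get (i.cast hl.symm)) := by
    rintro l rfl
    rfl
  rw [h _ (List.length_ofFn)]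
  simp

end Symmetry

open scoped Matrix.Norms.Elementwise

section Operator

variable {K : Type*} [NormedRing K] [NormedAlgebra ℝ K] {n k β : ℕ}

theorem applyAtZero_eq (e : Fin β → K) (P : MvPolynomial (Coord n k β) ℂ)
    (f : Matrix (Fin n) (Fin k) K → ℂ) :
    applyAtZero e P f =
      (MvPolynomial.basisMonomials (Coord n k β) ℂ).constr ℂ (fun α => partialAtZero e α f) P := by
  conv_rhs => rw [P.as_sum, map_sum]
  refine Finset.sum_congr rfl fun α _ => ?_
  have h := (MvPolynomial.basisMonomials (Coord n k β) ℂ).constr_basis ℂ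
    (fun α => partialAtZero e α f) α
  rw [MvPolynomial.coe_basisMonomials] at h
  rw [show MvPolynomial.monomial α (P.coeff α) = P.coeff α • MvPolynomial.monomial α (1 : ℂ) by
    rw [MvPolynomial.smul_monomial, smul_eq_mul, mul_one], map_smul, h, smul_eq_mul]

/-- `applyAtZero` as a linear functional on polynomials. -/
noncomputable def applyAtZeroLinear (e : Fin β → K) (f : Matrix (Fin n) (Fin k) K → ℂ) :
    MvPolynomial (Coord n k β) ℂ →ₗ[ℂ] ℂ :=
  (MvPolynomial.basisMonomials (Coord n k β) ℂ).constr ℂ fun α => partialAtZero e α f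

theorem applyAtZeroLinear_apply (e : Fin β → K) (P : MvPolynomial (Coord n k β) ℂ)
    (f : Matrix (Fin n) (Fin k) K → ℂ) : applyAtZeroLinear e f P = applyAtZero e P f :=
  (applyAtZero_eq e P f).symm

/-- Replaces the arbitrary ordering hidden in `partialAtZero` by any given sequence of directions;
the two lists are permutations of each other. -/
theorem applyAtZeroLinear_prod_X (e : Fin β → K) {f : Matrix (Fin n) (Fin k) K → ℂ}
    {Ω : Set (Matrix (Fin n) (Fin k) K)} (hΩ : IsOpen Ω) (h0 : 0 ∈ Ω) (hf : ContDiffOn ℝ ∞ f Ω)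
    {d : ℕ} (r : Fin d → Coord n k β) :
    applyAtZeroLinear e f (∏ i, MvPolynomial.X (r i)) =
      iteratedFDeriv ℝ d f 0 fun i => direction e (r i) := by
  have h1 : (∏ i, MvPolynomial.X (r i) : MvPolynomial (Coord n k β) ℂ) =
      MvPolynomial.monomial (∑ i, Finsupp.single (r i) 1) 1 := by
    rw [MvPolynomial.monomial_sum_one]
    rfl
  have h2 := (MvPolynomial.basisMonomials (Coord n k β) ℂ).constr_basis ℂ
    (fun α => partialAtZero e α f) (∑ i, Finsupp.single (r i) 1)
  rw [MvPolynomial.coe_basisMonomials] at h2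
  rw [h1, applyAtZeroLinear, h2, ← listDeriv_ofFn (direction e)]
  refine listDeriv_perm (direction e) hΩ hf ?_ 0 h0
  rw [← Multiset.coe_eq_coe, Multiset.coe_toList, Finsupp.toMultiset_sum]
  simp only [Finsupp.toMultiset_single, one_smul]
  rw [← Fin.univ_val_map, ← Multiset.sum_map_singleton (Finset.univ.val.map r), Multiset.map_map]
  rfl

theorem iteratedFDeriv_sum_smul_direction (e : Fin β → K) (f : Matrix (Fin n) (Fin k) K → ℂ)
    (d : ℕ) (x : Coord n k β → ℝ) :
    iteratedFDeriv ℝ d f 0 (fun _ => ∑ c, x c • direction e c) =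
      ∑ r : Fin d → Coord n k β,
        (∏ i, x (r i)) • iteratedFDeriv ℝ d f 0 fun i => direction e (r i) := by
  have h := (iteratedFDeriv ℝ d f 0).toMultilinearMap.map_sum
    (fun (_ : Fin d) (c : Coord n k β) => x c • direction e c)
  simp only [ContinuousMultilinearMap.coe_coe] at h
  rw [h]
  exact Finset.sum_congr rfl fun r _ =>
    (iteratedFDeriv ℝ d f 0).map_smul_univ (fun i => x (r i)) fun i => direction e (r i)

end Operator

/-! ### Integration of homogeneous Taylor polynomials -/

section Homogeneous

variable {K : Type*} [NormedRing K] [StarRing K] [NormedAlgebra ℝ K]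
  {β : ℕ} [NeZero β] {e : Fin β → K} {re : K →ₗ[ℝ] ℝ}

/-- The real coordinates of a matrix. -/
noncomputable def coordinate (e : Fin β → K) (re : K →ₗ[ℝ] ℝ) {n k : ℕ}
    (A : Matrix (Fin n) (Fin k) K) (c : Coord n k β) : ℝ :=
  entryRe re (star (e c.2.2)) c.1 c.2.1 A

theorem sum_smul_direction_apply (e : Fin β → K) {n k : ℕ} (y : Coord n k β → ℝ) (i : Fin n)
    (j : Fin k) : (∑ c, y c • direction e c) i j = ∑ a, y (i, j, a) • e a := by
  rw [Fintype.sum_prod_type, Matrix.sum_apply, Finset.sum_eq_single i, Fintype.sum_prod_type,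
    Matrix.sum_apply, Finset.sum_eq_single j, Matrix.sum_apply]
  · exact Finset.sum_congr rfl fun c _ => by simp [direction]
  · intro j' _ hj'
    rw [Matrix.sum_apply]
    exact Finset.sum_eq_zero fun c _ => by simp [direction, hj']
  · simp
  · intro i' _ hi'
    rw [Matrix.sum_apply]
    exact Finset.sum_eq_zero fun c _ => by simp [direction, hi']
  · simp

theorem sum_coordinate_smul_direction (S : IsScalarSystem e re) {n k : ℕ}
    (A : Matrix (Fin n) (Fin k) K) : ∑ c, coordinate e re A c • direction e c = A := by
  ext i j
  rw [sum_smul_direction_apply]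
  conv_rhs => rw [S.eq_sum (A i j)]
  rfl

theorem re_trace_gram_eq_sum (S : IsScalarSystem e re) {n k : ℕ}
    (A : Matrix (Fin n) (Fin k) K) (y : Coord n k β → ℝ) :
    re (Aᴴ * ∑ c, y c • direction e c).trace = ∑ c, coordinate e re A c * y c := by
  rw [Matrix.mul_sum, Matrix.trace_sum, map_sum]
  refine Finset.sum_congr rfl fun c _ => ?_
  have h : re (star (A c.1 c.2.1) * e c.2.2) = re (star (e c.2.2) * A c.1 c.2.1) := by
    rw [← S.re_star, star_mul, star_star]
  rw [Matrix.mul_smul, Matrix.trace_smul, map_smul, smul_eq_mul, mul_comm, direction,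
    Matrix.trace_mul_single, Matrix.conjTranspose_apply, MulOpposite.smul_eq_mul_unop,
    MulOpposite.unop_op, h]
  rfl

variable {m : ℕ} [ContinuousStar K] [CompactSpace (unitaryGp K (m + 2))]

theorem continuous_coordinate (S : IsScalarSystem e re) {n k : ℕ} (c : Coord n k β) :
    Continuous fun A : Matrix (Fin n) (Fin k) K => coordinate e re A c := by
  have := S.finiteDimensional
  exact continuous_of_matrix_linearMap _

/-- The differential operator whose values at the origin are the integrals of the homogeneous
components of a function. -/
noncomputable def momentPolynomial (e : Fin β → K) (re : K →ₗ[ℝ] ℝ) (m : ℕ)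
    [CompactSpace (unitaryGp K (m + 2))] (d : ℕ) : MvPolynomial (Coord (m + 2) 2 β) ℂ :=
  ∑ r : Fin d → Coord (m + 2) 2 β,
    ((∫ A, ∏ i, coordinate e re A (r i) ∂(stiefelMeasure K (m + 2) 2) : ℝ) : ℂ) •
      ∏ i, MvPolynomial.X (r i)

theorem integral_iteratedFDeriv (S : IsScalarSystem e re) {f : Matrix (Fin (m + 2)) (Fin 2) K → ℂ}
    {Ω : Set (Matrix (Fin (m + 2)) (Fin 2) K)} (hΩ : IsOpen Ω) (h0 : 0 ∈ Ω)
    (hf : ContDiffOn ℝ ∞ f Ω) (d : ℕ) :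
    ∫ A, iteratedFDeriv ℝ d f 0 (fun _ => A) ∂(stiefelMeasure K (m + 2) 2) =
      applyAtZero e (momentPolynomial e re m d) f := by
  have hc := fun c => continuous_coordinate (n := m + 2) (k := 2) S c
  rw [← applyAtZeroLinear_apply, momentPolynomial, map_sum]
  simp_rw [map_smul, applyAtZeroLinear_prod_X e hΩ h0 hf]
  have h : ∀ A : Matrix (Fin (m + 2)) (Fin 2) K, iteratedFDeriv ℝ d f 0 (fun _ => A) =
      ∑ r : Fin d → Coord (m + 2) 2 β, (∏ i, coordinate e re A (r i)) •
        iteratedFDeriv ℝ d f 0 fun i => direction e (r i) := by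
    intro A
    rw [← iteratedFDeriv_sum_smul_direction, sum_coordinate_smul_direction S]
  simp_rw [h]
  rw [integral_finsetSum _ fun r _ => integrable_stiefelMeasure (by fun_prop)]
  refine Finset.sum_congr rfl fun r _ => ?_
  rw [integral_smul_const, Complex.real_smul, smul_eq_mul]

/-- The symbol of the operator is a power moment of the linear form dual to `y`: expanding that
power over index tuples reproduces the coefficients of `momentPolynomial`. -/
theorem eval_momentPolynomial (S : IsScalarSystem e re) (d : ℕ) (y : Coord (m + 2) 2 β → ℝ) :
    MvPolynomial.eval (fun c => (y c : ℂ)) (momentPolynomial e re m d) =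
      ((∫ A, re (Aᴴ * ∑ c, y c • direction e c).trace ^ d ∂(stiefelMeasure K (m + 2) 2) : ℝ) : ℂ) := by
  have hc := fun c => continuous_coordinate (n := m + 2) (k := 2) S c
  have h : ∀ A : Matrix (Fin (m + 2)) (Fin 2) K, re (Aᴴ * ∑ c, y c • direction e c).trace ^ d =
      ∑ r : Fin d → Coord (m + 2) 2 β, (∏ i, coordinate e re A (r i)) * ∏ i, y (r i) := by
    intro A
    rw [re_trace_gram_eq_sum S, ← Fin.prod_const, Finset.prod_univ_sum, Fintype.piFinset_univ]
    exact Finset.sum_congr rfl fun r _ => Finset.prod_mul_distrib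
  simp_rw [h]
  rw [integral_finsetSum _ fun r _ => integrable_stiefelMeasure (by fun_prop)]
  simp only [momentPolynomial, map_sum, MvPolynomial.smul_eval, map_prod, MvPolynomial.eval_X]
  push_cast
  refine Finset.sum_congr rfl fun r _ => ?_
  rw [integral_mul_const]
  push_cast
  rfl

/-- The real line is an infinite subset of `ℂ` in every variable, so real points detect equality.
Operators can thus be compared through honest matrices. -/
theorem eq_of_eval_real_eq {σ : Type*} {P Q : MvPolynomial σ ℂ}
    (h : ∀ y : σ → ℝ, MvPolynomial.eval (fun c => (y c : ℂ)) P =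
      MvPolynomial.eval (fun c => (y c : ℂ)) Q) : P = Q := by
  refine MvPolynomial.funext_set (fun _ => Set.range ((↑) : ℝ → ℂ))
    (fun _ => Set.infinite_range_of_injective Complex.ofReal_injective) fun x hx => ?_
  choose y hy using fun c => hx c (Set.mem_univ c)
  rw [← funext hy]
  exact h y

/-- The integral of a homogeneous component of even degree is a term of the series. -/
theorem integral_taylor_eq_pizzettiTerm (S : IsScalarSystem e re)
    {I₁ I₂ : MvPolynomial (Coord (m + 2) 2 β) ℂ}
    (h₁ : ∀ y : Coord (m + 2) 2 β → ℝ, MvPolynomial.eval (fun c => (y c : ℂ)) I₁ =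
      (gramTrace re (∑ c, y c • direction e c) : ℂ))
    (h₂ : ∀ y : Coord (m + 2) 2 β → ℝ, MvPolynomial.eval (fun c => (y c : ℂ)) I₂ =
      (gramDet re (∑ c, y c • direction e c) : ℂ))
    {f : Matrix (Fin (m + 2)) (Fin 2) K → ℂ}
    {Ω : Set (Matrix (Fin (m + 2)) (Fin 2) K)} (hΩ : IsOpen Ω) (h0 : 0 ∈ Ω)
    (hf : ContDiffOn ℝ ∞ f Ω) (j : ℕ) :
    ∫ A, ((2 * j).factorial : ℝ)⁻¹ • iteratedFDeriv ℝ (2 * j) f 0 (fun _ => A)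
      ∂(stiefelMeasure K (m + 2) 2) = pizzettiTerm e I₁ I₂ f j := by
  have hβ : (0 : ℝ) < β := by exact_mod_cast Nat.pos_of_ne_zero (NeZero.ne β)
  -- An identity of operators, checked on symbols at real points, where it is
  -- `integral_re_trace_pow`.
  have hpoly : momentPolynomial e re m (2 * j) =
      (((2 * j).factorial * (4 ^ j * rising (β * (m + 2) / 2) j)⁻¹ : ℝ) : ℂ) •
        ∑ l ∈ Finset.range (j / 2 + 1), (((rising (β * (m + 1) / 2) l)⁻¹ /
          ((j - 2 * l).factorial * l.factorial) : ℝ) : ℂ) • (I₁ ^ (j - 2 * l) * I₂ ^ l) := by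
    refine eq_of_eval_real_eq fun y => ?_
    rw [eval_momentPolynomial S, integral_re_trace_pow S]
    simp only [MvPolynomial.smul_eval, map_sum, map_mul, map_pow, h₁, h₂]
    push_cast
    congr 1
    refine Finset.sum_congr rfl fun l _ => ?_
    ring
  rw [integral_smul, integral_iteratedFDeriv S hΩ h0 hf, ← applyAtZeroLinear_apply, hpoly,
    map_smul, map_sum, pizzettiTerm]
  have hN : (0 : ℝ) < β * (m + 2 : ℕ) / 2 := by positivity
  have hv : (0 : ℝ) < β * ((m + 2 : ℕ) - 1) / 2 := by push_cast; ring_nf; positivity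
  have e1 : (β * (m + 2 : ℕ) / 2 : ℝ) = β * (m + 2) / 2 := by push_cast; ring
  have e2 : (β * ((m + 2 : ℕ) - 1) / 2 : ℝ) = β * (m + 1) / 2 := by push_cast; ring
  have hG : (Real.Gamma (β * (m + 2 : ℕ) / 2) / (4 ^ j * Real.Gamma (j + β * (m + 2 : ℕ) / 2)) : ℝ) =
      (4 ^ j * rising (β * (m + 2) / 2) j)⁻¹ := by
    rw [mul_comm (4 ^ j : ℝ), ← div_div, Gamma_div_Gamma_nat_add hN, e1, mul_comm (4 ^ j : ℝ),
      mul_inv, div_eq_mul_inv]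
  rw [hG, Complex.real_smul, smul_eq_mul, ← mul_assoc, ← Complex.ofReal_mul, ← mul_assoc,
    inv_mul_cancel₀ (by positivity), one_mul]
  congr 1
  refine Finset.sum_congr rfl fun l _ => ?_
  rw [Gamma_div_Gamma_nat_add hv, e2, map_smul, applyAtZeroLinear_apply, smul_eq_mul]
  push_cast
  ring

end Homogeneous

/-! ### The symbols of the invariant operators -/

section Invariants

variable {K : Type*} [NormedRing K] [StarRing K] [NormedAlgebra ℝ K]
  {β : ℕ} [NeZero β] {e : Fin β → K} {re : K →ₗ[ℝ] ℝ}

theorem re_star_mul_self_sum (S : IsScalarSystem e re) (y : Fin β → ℝ) :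
    re (star (∑ a, y a • e a) * ∑ a, y a • e a) = ∑ a, y a ^ 2 := by
  rw [S.re_star_mul_self]
  refine Finset.sum_congr rfl fun c _ => ?_
  simp [Finset.mul_sum, S.re_star_mul]

theorem gramTrace_sum_smul_direction (S : IsScalarSystem e re) {n : ℕ}
    (y : Coord n 2 β → ℝ) :
    gramTrace re (∑ c, y c • direction e c) =
      ∑ i, ∑ a, y (i, 0, a) ^ 2 + ∑ i, ∑ a, y (i, 1, a) ^ 2 := by
  simp only [gramTrace, Matrix.trace, Matrix.diag_apply, Matrix.mul_apply,
    Matrix.conjTranspose_apply, sum_smul_direction_apply, Fin.sum_univ_two]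
  rw [map_add, map_sum, map_sum]
  simp only [re_star_mul_self_sum S]

/-- The Gram matrix has real diagonal entries `x`, `y` and off-diagonal entries `q`, `q̄`, so
`((x+y)² - (x² + y² + 2|q|²))/2 = x y - |q|²`. -/
theorem gramDet_sum_smul_direction (S : IsScalarSystem e re) {n : ℕ} (y : Coord n 2 β → ℝ) :
    gramDet re (∑ c, y c • direction e c) =
      (∑ i, ∑ a, y (i, 0, a) ^ 2) * (∑ i, ∑ a, y (i, 1, a) ^ 2) -
      ∑ b, (∑ i, re (star (e b) *
        (star (∑ a, y (i, 0, a) • e a) * ∑ a, y (i, 1, a) • e a))) ^ 2 := by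
  set B : Matrix (Fin n) (Fin 2) K := ∑ c, y c • direction e c with hB
  have hdiag : ∀ j, (Bᴴ * B) j j = (∑ i, ∑ a, y (i, j, a) ^ 2) • (1 : K) := by
    intro j
    simp only [Matrix.mul_apply, Matrix.conjTranspose_apply, Finset.sum_smul]
    refine Finset.sum_congr rfl fun i _ => ?_
    rw [S.star_mul_self, hB, sum_smul_direction_apply, re_star_mul_self_sum S, Finset.sum_smul]
  have h10 : (Bᴴ * B) 1 0 = star ((Bᴴ * B) 0 1) := by
    simp [Matrix.mul_apply]
  have hq : (Bᴴ * B) 0 1 =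
      ∑ i, star (∑ a, y (i, 0, a) • e a) * ∑ a, y (i, 1, a) • e a := by
    simp only [Matrix.mul_apply, Matrix.conjTranspose_apply, hB, sum_smul_direction_apply]
  have hns : re (star ((Bᴴ * B) 0 1) * (Bᴴ * B) 0 1) = ∑ b, (∑ i, re (star (e b) *
        (star (∑ a, y (i, 0, a) • e a) * ∑ a, y (i, 1, a) • e a))) ^ 2 := by
    rw [S.re_star_mul_self]
    refine Finset.sum_congr rfl fun b _ => ?_
    rw [hq, Finset.mul_sum, map_sum]
  rw [← hns, gramDet]
  simp only [Matrix.trace, Matrix.diag_apply, Matrix.mul_apply (M := Bᴴ * B), Fin.sum_univ_two,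
    hdiag, h10, map_add, S.re_mul_comm ((Bᴴ * B) 0 1), smul_mul_smul_comm, map_smul, mul_one,
    S.re_one, smul_eq_mul]
  ring

theorem eval_I₁Real {n : ℕ} (y : Coord n 2 1 → ℝ) :
    MvPolynomial.eval (fun c => (y c : ℂ)) (I₁Real n) =
      (gramTrace (LinearMap.id : ℝ →ₗ[ℝ] ℝ) (∑ c, y c • direction realUnits c) : ℂ) := by
  rw [gramTrace_sum_smul_direction isScalarSystem_real]
  simp [I₁Real, Matrix.trace, Matrix.mul_apply, dagger, nablaReal, sq]

theorem eval_I₂Real {n : ℕ} (y : Coord n 2 1 → ℝ) :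
    MvPolynomial.eval (fun c => (y c : ℂ)) (I₂Real n) =
      (gramDet (LinearMap.id : ℝ →ₗ[ℝ] ℝ) (∑ c, y c • direction realUnits c) : ℂ) := by
  rw [gramDet_sum_smul_direction isScalarSystem_real]
  have hq : ∑ b, (∑ i, (LinearMap.id : ℝ →ₗ[ℝ] ℝ) (star (realUnits b) *
      (star (∑ a, y (i, 0, a) • realUnits a) * ∑ a, y (i, 1, a) • realUnits a))) ^ 2 =
        (∑ i, y (i, 0, 0) * y (i, 1, 0)) ^ 2 := by
    simp [realUnits]
  have hg : ∀ a b, MvPolynomial.eval (fun c => (y c : ℂ))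
      ((dagger (nablaReal n 2) * nablaReal n 2) a b) =
        ∑ i, (y (i, a, 0) : ℂ) * y (i, b, 0) := by
    intro a b
    simp [Matrix.mul_apply, dagger, nablaReal]
  have h10 : ∑ i, (y (i, 1, 0) : ℂ) * y (i, 0, 0) = ∑ i, (y (i, 0, 0) : ℂ) * y (i, 1, 0) :=
    Finset.sum_congr rfl fun i _ => mul_comm _ _
  rw [hq, I₂Real, Matrix.det_fin_two, map_sub, map_mul, map_mul, hg, hg, hg, hg, h10]
  simp [sq]

theorem eval_gram_nablaComplex {n : ℕ} (y : Coord n 2 2 → ℝ) (a b : Fin 2) :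
    MvPolynomial.eval (fun c => (y c : ℂ))
      ((dagger (nablaComplex n 2) * nablaComplex n 2) a b) =
        ∑ i, ((y (i, a, 0) : ℂ) + Complex.I * y (i, a, 1)) *
          (y (i, b, 0) - Complex.I * y (i, b, 1)) := by
  simp [Matrix.mul_apply, dagger, nablaComplex]

theorem eval_gram_nablaComplex_self {n : ℕ} (y : Coord n 2 2 → ℝ) (a : Fin 2) :
    MvPolynomial.eval (fun c => (y c : ℂ))
      ((dagger (nablaComplex n 2) * nablaComplex n 2) a a) =
        ∑ i, ∑ b, (y (i, a, b) : ℂ) ^ 2 := by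
  rw [eval_gram_nablaComplex]
  refine Finset.sum_congr rfl fun i _ => ?_
  rw [Fin.sum_univ_two]
  linear_combination (-(y (i, a, 1) : ℂ) * y (i, a, 1)) * Complex.I_sq

theorem eval_I₁Complex {n : ℕ} (y : Coord n 2 2 → ℝ) :
    MvPolynomial.eval (fun c => (y c : ℂ)) (I₁Complex n) =
      (gramTrace Complex.reLm (∑ c, y c • direction complexUnits c) : ℂ) := by
  rw [gramTrace_sum_smul_direction isScalarSystem_complex, I₁Complex, Matrix.trace,
    Fin.sum_univ_two, map_add, Matrix.diag_apply, Matrix.diag_apply,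
    eval_gram_nablaComplex_self, eval_gram_nablaComplex_self]
  push_cast
  rfl

theorem eval_I₂Complex {n : ℕ} (y : Coord n 2 2 → ℝ) :
    MvPolynomial.eval (fun c => (y c : ℂ)) (I₂Complex n) =
      (gramDet Complex.reLm (∑ c, y c • direction complexUnits c) : ℂ) := by
  rw [gramDet_sum_smul_direction isScalarSystem_complex]
  set s₀ := ∑ i, (y (i, 0, 0) * y (i, 1, 0) + y (i, 0, 1) * y (i, 1, 1)) with hs₀
  set s₁ := ∑ i, (y (i, 0, 0) * y (i, 1, 1) - y (i, 0, 1) * y (i, 1, 0)) with hs₁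
  have hq : ∑ b, (∑ i, Complex.reLm (star (complexUnits b) *
      (star (∑ a, y (i, 0, a) • complexUnits a) * ∑ a, y (i, 1, a) • complexUnits a))) ^ 2 =
        s₀ ^ 2 + s₁ ^ 2 := by
    rw [Fin.sum_univ_two]
    congr 2
    · exact Finset.sum_congr rfl fun i _ => by simp [complexUnits]
    · exact Finset.sum_congr rfl fun i _ => by simp [complexUnits]; ring
  have h01 : ∑ i, ((y (i, 0, 0) : ℂ) + Complex.I * y (i, 0, 1)) *
      (y (i, 1, 0) - Complex.I * y (i, 1, 1)) = s₀ - Complex.I * s₁ := by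
    rw [hs₀, hs₁]
    push_cast
    rw [Finset.mul_sum, ← Finset.sum_sub_distrib]
    refine Finset.sum_congr rfl fun i _ => ?_
    linear_combination (-(y (i, 0, 1) : ℂ) * y (i, 1, 1)) * Complex.I_sq
  have h10 : ∑ i, ((y (i, 1, 0) : ℂ) + Complex.I * y (i, 1, 1)) *
      (y (i, 0, 0) - Complex.I * y (i, 0, 1)) = s₀ + Complex.I * s₁ := by
    rw [hs₀, hs₁]
    push_cast
    rw [Finset.mul_sum, ← Finset.sum_add_distrib]
    refine Finset.sum_congr rfl fun i _ => ?_
    linear_combination (-(y (i, 0, 1) : ℂ) * y (i, 1, 1)) * Complex.I_sq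
  rw [hq, I₂Complex, Matrix.det_fin_two, map_sub, map_mul, map_mul,
    eval_gram_nablaComplex_self, eval_gram_nablaComplex_self, eval_gram_nablaComplex,
    eval_gram_nablaComplex, h01, h10]
  push_cast
  linear_combination (s₁ : ℂ) ^ 2 * Complex.I_sq

/-! ### Pfaffians of order four and the quaternionic invariants. -/

theorem sum_perm_fin_succ {n : ℕ} {R : Type*} [AddCommMonoid R] (f : Equiv.Perm (Fin (n + 1)) → R) :
    ∑ σ, f σ = ∑ p : Fin (n + 1), ∑ τ : Equiv.Perm (Fin n),
      f (Equiv.Perm.decomposeFin.symm (p, τ)) := by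
  rw [← Equiv.Perm.decomposeFin.symm.sum_comp, Fintype.sum_prod_type]

/-- The `24` permutations fall into the three perfect matchings of four points. Each matching is hit
`8` times with equal contributions, since a swap inside a pair changes both the sign and the entry,
and a swap of the pairs changes neither. -/
theorem sum_perm_fin_four_antisymm {R : Type*} [CommRing R] (N : Fin 4 → Fin 4 → R)
    (h : ∀ i j, N j i = -N i j) :
    ∑ σ : Equiv.Perm (Fin 4), Equiv.Perm.sign σ • (N (σ 0) (σ 1) * N (σ 2) (σ 3)) =
     8 * (N 0 1 * N 2 3 - N 0 2 * N 1 3 + N 0 3 * N 1 2) := by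
  have e1 : ∀ (p : Fin 4) τ, Equiv.Perm.decomposeFin.symm (p, τ) 1 = Equiv.swap 0 p (τ 0).succ :=
    fun p τ => Equiv.Perm.decomposeFin_symm_apply_succ τ p 0
  have e2 : ∀ (p : Fin 4) τ, Equiv.Perm.decomposeFin.symm (p, τ) 2 = Equiv.swap 0 p (τ 1).succ :=
    fun p τ => Equiv.Perm.decomposeFin_symm_apply_succ τ p 1
  have e3 : ∀ (p : Fin 4) τ, Equiv.Perm.decomposeFin.symm (p, τ) 3 = Equiv.swap 0 p (τ 2).succ :=
    fun p τ => Equiv.Perm.decomposeFin_symm_apply_succ τ p 2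
  have e4 : ∀ (p : Fin 3) τ, Equiv.Perm.decomposeFin.symm (p, τ) 1 = Equiv.swap 0 p (τ 0).succ :=
    fun p τ => Equiv.Perm.decomposeFin_symm_apply_succ τ p 0
  have e5 : ∀ (p : Fin 3) τ, Equiv.Perm.decomposeFin.symm (p, τ) 2 = Equiv.swap 0 p (τ 1).succ :=
    fun p τ => Equiv.Perm.decomposeFin_symm_apply_succ τ p 1
  have e6 : ∀ (p : Fin 2) τ, Equiv.Perm.decomposeFin.symm (p, τ) 1 = Equiv.swap 0 p (τ 0).succ :=
    fun p τ => Equiv.Perm.decomposeFin_symm_apply_succ τ p 0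
  have e0 : ∀ (m : ℕ) (p : Fin (m + 1)) τ, Equiv.Perm.decomposeFin.symm (p, τ) 0 = p := fun m p τ =>
    Equiv.Perm.decomposeFin_symm_apply_zero p τ
  have d4 : ∀ f : Equiv.Perm (Fin 4) → R, ∑ σ, f σ =
      ∑ p : Fin 4, ∑ τ : Equiv.Perm (Fin 3), f (Equiv.Perm.decomposeFin.symm (p, τ)) := sum_perm_fin_succ
  have d3 : ∀ f : Equiv.Perm (Fin 3) → R, ∑ σ, f σ =
      ∑ p : Fin 3, ∑ τ : Equiv.Perm (Fin 2), f (Equiv.Perm.decomposeFin.symm (p, τ)) := sum_perm_fin_succ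
  have d2 : ∀ f : Equiv.Perm (Fin 2) → R, ∑ σ, f σ =
      ∑ p : Fin 2, ∑ τ : Equiv.Perm (Fin 1), f (Equiv.Perm.decomposeFin.symm (p, τ)) := sum_perm_fin_succ
  simp only [d4, d3, d2, Fin.sum_univ_four, Fin.sum_univ_three, Fin.sum_univ_two,
    Equiv.Perm.decomposeFin.symm_sign, Fintype.sum_unique, e0, e1, e2, e3, e4, e5, e6]
  have h10 := h 0 1
  have h20 := h 0 2
  have h30 := h 0 3
  have h21 := h 1 2
  have h31 := h 1 3
  have h32 := h 2 3
  simp [Equiv.swap_apply_def, h10, h20, h30, h21, h31, h32]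
  ring

theorem pfaffian_two {R : Type*} [CommRing R] [Algebra ℚ R]
    (M : Matrix (Fin 2 × Fin 2) (Fin 2 × Fin 2) R) (h : ∀ p q, M q p = -M p q) :
    pfaffian M = M (0, 0) (0, 1) * M (1, 0) (1, 1) - M (0, 0) (1, 0) * M (0, 1) (1, 1) +
      M (0, 0) (1, 1) * M (0, 1) (1, 0) := by
  let φ : Fin 4 ≃ Fin 2 × Fin 2 := (finProdFinEquiv (m := 2) (n := 2)).symm
  have hφ : φ 0 = (0, 0) ∧ φ 1 = (0, 1) ∧ φ 2 = (1, 0) ∧ φ 3 = (1, 1) := by decide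
  have hs : ∑ σ : Equiv.Perm (Fin 2 × Fin 2),
      Equiv.Perm.sign σ • ∏ j : Fin 2, M (σ (j, 0)) (σ (j, 1)) =
      8 * (M (0, 0) (0, 1) * M (1, 0) (1, 1) - M (0, 0) (1, 0) * M (0, 1) (1, 1) +
      M (0, 0) (1, 1) * M (0, 1) (1, 0)) := by
    have h4 := sum_perm_fin_four_antisymm (fun i j => M (φ i) (φ j)) fun i j => h _ _
    simp only [hφ.1, hφ.2.1, hφ.2.2.1, hφ.2.2.2] at h4
    rw [← h4, ← φ.permCongr.sum_comp]
    refine Finset.sum_congr rfl fun σ _ => ?_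
    rw [Equiv.Perm.sign_permCongr, Fin.prod_univ_two, ← hφ.1, ← hφ.2.1, ← hφ.2.2.1, ← hφ.2.2.2]
    simp [Equiv.permCongr_apply]
  have h8 : (8 : R) = algebraMap ℚ R 8 := (map_ofNat _ 8).symm
  rw [pfaffian, hs, h8, ← Algebra.smul_def, smul_smul]
  norm_num

theorem map_pfaffian {R R' : Type*} [CommRing R] [Algebra ℚ R] [CommRing R'] [Algebra ℚ R']
    (φ : R →+* R') {N : ℕ} (M : Matrix (Fin N × Fin 2) (Fin N × Fin 2) R) :
    φ (pfaffian M) = pfaffian (M.map φ) := by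
  simp only [pfaffian, map_rat_smul, map_sum, Units.smul_def, map_zsmul, map_prod,
    Matrix.map_apply]

theorem symplecticUnit_two_mul {R : Type*} [CommRing R] (M : Matrix (Fin 2 × Fin 2) (Fin 2 × Fin 2) R)
    (a : Fin 2) (q : Fin 2 × Fin 2) :
    (symplecticUnit R 2 * M) (a, 0) q = M (a, 1) q ∧
      (symplecticUnit R 2 * M) (a, 1) q = -M (a, 0) q := by
  constructor <;>
  simp [Matrix.mul_apply, Fintype.sum_prod_type, symplecticUnit]

/-- The components of the entries of the quaternionic Gram matrix. -/
noncomputable def gramComponent {n : ℕ} (y : Coord n 2 4 → ℝ) (k : Fin 4) (a b : Fin 2) : ℝ :=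
  ∑ i, quaternionRe (star (quaternionUnits k) *
    (star (∑ c, y (i, a, c) • quaternionUnits c) * ∑ c, y (i, b, c) • quaternionUnits c))

theorem sum_smul_quaternionUnits (x : Fin 4 → ℝ) :
    (∑ c, x c • quaternionUnits c).re = x 0 ∧ (∑ c, x c • quaternionUnits c).imI = x 1 ∧
      (∑ c, x c • quaternionUnits c).imJ = x 2 ∧ (∑ c, x c • quaternionUnits c).imK = x 3 := by
  refine ⟨?_, ?_, ?_, ?_⟩ <;> simp [Fin.sum_univ_four, quaternionUnits_re, quaternionUnits_imI,
    quaternionUnits_imJ, quaternionUnits_imK]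

theorem gramComponent_zero {n : ℕ} (y : Coord n 2 4 → ℝ) (a b : Fin 2) :
    gramComponent y 0 a b = ∑ i, (y (i, a, 0) * y (i, b, 0) + y (i, a, 1) * y (i, b, 1) +
      y (i, a, 2) * y (i, b, 2) + y (i, a, 3) * y (i, b, 3)) := by
  refine Finset.sum_congr rfl fun i _ => ?_
  obtain ⟨ha0, ha1, ha2, ha3⟩ := sum_smul_quaternionUnits fun c => y (i, a, c)
  obtain ⟨hb0, hb1, hb2, hb3⟩ := sum_smul_quaternionUnits fun c => y (i, b, c)
  simp only [quaternionRe_apply, Quaternion.re_mul, Quaternion.imI_mul, Quaternion.imJ_mul,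
    Quaternion.imK_mul, Quaternion.re_star, Quaternion.imI_star, Quaternion.imJ_star,
    Quaternion.imK_star, quaternionUnits_re, quaternionUnits_imI, quaternionUnits_imJ,
    quaternionUnits_imK, ha0, ha1, ha2, ha3, hb0, hb1, hb2, hb3]
  simp

theorem gramComponent_one {n : ℕ} (y : Coord n 2 4 → ℝ) (a b : Fin 2) :
    gramComponent y 1 a b = ∑ i, (y (i, a, 0) * y (i, b, 1) - y (i, a, 1) * y (i, b, 0) -
      y (i, a, 2) * y (i, b, 3) + y (i, a, 3) * y (i, b, 2)) := by
  refine Finset.sum_congr rfl fun i _ => ?_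
  obtain ⟨ha0, ha1, ha2, ha3⟩ := sum_smul_quaternionUnits fun c => y (i, a, c)
  obtain ⟨hb0, hb1, hb2, hb3⟩ := sum_smul_quaternionUnits fun c => y (i, b, c)
  simp only [quaternionRe_apply, Quaternion.re_mul, Quaternion.imI_mul, Quaternion.imJ_mul,
    Quaternion.imK_mul, Quaternion.re_star, Quaternion.imI_star, Quaternion.imJ_star,
    Quaternion.imK_star, quaternionUnits_re, quaternionUnits_imI, quaternionUnits_imJ,
    quaternionUnits_imK, ha0, ha1, ha2, ha3, hb0, hb1, hb2, hb3]
  simp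
  ring

theorem gramComponent_two {n : ℕ} (y : Coord n 2 4 → ℝ) (a b : Fin 2) :
    gramComponent y 2 a b = ∑ i, (y (i, a, 0) * y (i, b, 2) + y (i, a, 1) * y (i, b, 3) -
      y (i, a, 2) * y (i, b, 0) - y (i, a, 3) * y (i, b, 1)) := by
  refine Finset.sum_congr rfl fun i _ => ?_
  obtain ⟨ha0, ha1, ha2, ha3⟩ := sum_smul_quaternionUnits fun c => y (i, a, c)
  obtain ⟨hb0, hb1, hb2, hb3⟩ := sum_smul_quaternionUnits fun c => y (i, b, c)
  simp only [quaternionRe_apply, Quaternion.re_mul, Quaternion.imI_mul, Quaternion.imJ_mul,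
    Quaternion.imK_mul, Quaternion.re_star, Quaternion.imI_star, Quaternion.imJ_star,
    Quaternion.imK_star, quaternionUnits_re, quaternionUnits_imI, quaternionUnits_imJ,
    quaternionUnits_imK, ha0, ha1, ha2, ha3, hb0, hb1, hb2, hb3]
  simp
  ring

theorem gramComponent_three {n : ℕ} (y : Coord n 2 4 → ℝ) (a b : Fin 2) :
    gramComponent y 3 a b = ∑ i, (y (i, a, 0) * y (i, b, 3) - y (i, a, 1) * y (i, b, 2) +
      y (i, a, 2) * y (i, b, 1) - y (i, a, 3) * y (i, b, 0)) := by
  refine Finset.sum_congr rfl fun i _ => ?_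
  obtain ⟨ha0, ha1, ha2, ha3⟩ := sum_smul_quaternionUnits fun c => y (i, a, c)
  obtain ⟨hb0, hb1, hb2, hb3⟩ := sum_smul_quaternionUnits fun c => y (i, b, c)
  simp only [quaternionRe_apply, Quaternion.re_mul, Quaternion.imI_mul, Quaternion.imJ_mul,
    Quaternion.imK_mul, Quaternion.re_star, Quaternion.imI_star, Quaternion.imJ_star,
    Quaternion.imK_star, quaternionUnits_re, quaternionUnits_imI, quaternionUnits_imJ,
    quaternionUnits_imK, ha0, ha1, ha2, ha3, hb0, hb1, hb2, hb3]
  simp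
  ring

theorem gramComponent_swap {n : ℕ} (y : Coord n 2 4 → ℝ) (a b : Fin 2) :
    gramComponent y 0 b a = gramComponent y 0 a b ∧
    gramComponent y 1 b a = -gramComponent y 1 a b ∧
    gramComponent y 2 b a = -gramComponent y 2 a b ∧
    gramComponent y 3 b a = -gramComponent y 3 a b := by
  simp only [gramComponent_zero, gramComponent_one, gramComponent_two, gramComponent_three,
    ← Finset.sum_neg_distrib]
  refine ⟨?_, ?_, ?_, ?_⟩ <;> exact Finset.sum_congr rfl fun i _ => by ring

/-- The symbol of `∇` is the entrywise complex conjugate of the embedded matrix, so each block is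
the conjugate of the embedded quaternionic Gram entry. -/
theorem eval_gram_nablaQuaternion {n : ℕ} (y : Coord n 2 4 → ℝ) (a b : Fin 2) :
    let N := (dagger (nablaQuaternion n 2) * nablaQuaternion n 2).map
      (MvPolynomial.eval fun c => (y c : ℂ))
    N (a, 0) (b, 0) = gramComponent y 0 a b - Complex.I * gramComponent y 1 a b ∧
    N (a, 0) (b, 1) = gramComponent y 2 a b - Complex.I * gramComponent y 3 a b ∧
    N (a, 1) (b, 0) = -(gramComponent y 2 a b + Complex.I * gramComponent y 3 a b) ∧
    N (a, 1) (b, 1) = gramComponent y 0 a b + Complex.I * gramComponent y 1 a b := by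
  intro N
  have hN : ∀ s t, N (a, s) (b, t) = ∑ i, ∑ u, MvPolynomial.eval (fun c => (y c : ℂ))
      (MvPolynomial.map (starRingEnd ℂ) (nablaQuaternion n 2 (i, u) (a, s)) *
        nablaQuaternion n 2 (i, u) (b, t)) := by
    intro s t
    simp only [N, Matrix.map_apply, Matrix.mul_apply, dagger, Matrix.transpose_apply, map_sum,
      Fintype.sum_prod_type]
  simp only [hN, gramComponent_zero, gramComponent_one, gramComponent_two, gramComponent_three]
  push_cast
  simp only [Finset.mul_sum, ← Finset.sum_neg_distrib, ← Finset.sum_add_distrib,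
    ← Finset.sum_sub_distrib]
  refine ⟨?_, ?_, ?_, ?_⟩ <;>
  · refine Finset.sum_congr rfl fun i _ => ?_
    rw [Fin.sum_univ_two]
    simp [nablaQuaternion]
    ring_nf
    simp only [Complex.I_sq]
    ring

theorem eval_I₁Quaternion {n : ℕ} (y : Coord n 2 4 → ℝ) :
    MvPolynomial.eval (fun c => (y c : ℂ)) (I₁Quaternion n) =
      (gramTrace quaternionRe (∑ c, y c • direction quaternionUnits c) : ℂ) := by
  have h := fun a => eval_gram_nablaQuaternion y a a
  simp only [Matrix.map_apply] at h
  have hs : ∀ a, ∑ i, ∑ c, y (i, a, c) ^ 2 = gramComponent y 0 a a := by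
    intro a
    rw [gramComponent_zero]
    exact Finset.sum_congr rfl fun i _ => by rw [Fin.sum_univ_four]; ring
  rw [gramTrace_sum_smul_direction isScalarSystem_quaternion, hs, hs, I₁Quaternion, map_mul,
    MvPolynomial.eval_C, Matrix.trace, Fintype.sum_prod_type]
  simp only [Fin.sum_univ_two, map_add, Matrix.diag_apply, (h _).1, (h _).2.2.2]
  push_cast
  ring

/-- Of the three matchings in the Pfaffian, the one inside the diagonal blocks gives the product of
the squared column norms; the other two together give minus the squared norm of the off-diagonal
Gram entry. -/
theorem eval_I₂Quaternion {n : ℕ} (y : Coord n 2 4 → ℝ) :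
    MvPolynomial.eval (fun c => (y c : ℂ)) (I₂Quaternion n) =
      (gramDet quaternionRe (∑ c, y c • direction quaternionUnits c) : ℂ) := by
  have hs : ∀ a, ∑ i, ∑ c, y (i, a, c) ^ 2 = gramComponent y 0 a a := by
    intro a
    rw [gramComponent_zero]
    exact Finset.sum_congr rfl fun i _ => by rw [Fin.sum_univ_four]; ring
  have hz : ∀ a, gramComponent y 1 a a = 0 := fun a => by
    linarith [(gramComponent_swap y a a).2.1]
  have hdet : gramDet quaternionRe (∑ c, y c • direction quaternionUnits c) =
      gramComponent y 0 0 0 * gramComponent y 0 1 1 - ∑ k, gramComponent y k 0 1 ^ 2 := by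
    rw [gramDet_sum_smul_direction isScalarSystem_quaternion, hs, hs]
    rfl
  have hJ : (symplecticUnit (MvPolynomial (Coord n 2 4) ℂ) 2).map
      (MvPolynomial.eval fun c => (y c : ℂ)) = symplecticUnit ℂ 2 := by
    ext ⟨a, s⟩ ⟨b, t⟩
    fin_cases s <;> fin_cases t <;> by_cases hab : a = b <;> simp [symplecticUnit, hab]
  have h := fun a b => eval_gram_nablaQuaternion y a b
  rw [I₂Quaternion, map_pfaffian, Matrix.map_mul, hJ, hdet]
  set N := (dagger (nablaQuaternion n 2) * nablaQuaternion n 2).map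
      (MvPolynomial.eval fun c => (y c : ℂ)) with hN
  have h' : ∀ a b,
    N (a, 0) (b, 0) = gramComponent y 0 a b - Complex.I * gramComponent y 1 a b ∧
    N (a, 0) (b, 1) = gramComponent y 2 a b - Complex.I * gramComponent y 3 a b ∧
    N (a, 1) (b, 0) = -(gramComponent y 2 a b + Complex.I * gramComponent y 3 a b) ∧
    N (a, 1) (b, 1) = gramComponent y 0 a b + Complex.I * gramComponent y 1 a b := h
  rw [pfaffian_two]
  · simp only [(symplecticUnit_two_mul N _ _).1, (symplecticUnit_two_mul N _ _).2, (h' _ _).1,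
      (h' _ _).2.1, (h' _ _).2.2.1, (h' _ _).2.2.2, hz, Fin.sum_univ_four]
    push_cast
    linear_combination ((gramComponent y 1 0 1 : ℂ) ^ 2 + (gramComponent y 3 0 1 : ℂ) ^ 2) *
      Complex.I_sq
  · rintro ⟨a, s⟩ ⟨b, t⟩
    obtain ⟨g0, g1, g2, g3⟩ := gramComponent_swap y a b
    fin_cases s <;> fin_cases t <;>
      simp [(symplecticUnit_two_mul N _ _).1, (symplecticUnit_two_mul N _ _).2, (h' _ _).1,
        (h' _ _).2.1, (h' _ _).2.2.1, (h' _ _).2.2.2, g0, g1, g2, g3] <;> ring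

end Invariants

/-! ### Taylor series -/

section Taylor

variable {E : Type*} [NormedAddCommGroup E] [NormedSpace ℝ E]

/-- The homogeneous component of degree `d` of the Taylor series at the origin. -/
noncomputable def taylorTerm (f : E → ℂ) (d : ℕ) (A : E) : ℂ :=
  (d.factorial : ℝ)⁻¹ • iteratedFDeriv ℝ d f 0 (fun _ => A)

theorem taylorTerm_smul (f : E → ℂ) (d : ℕ) (t : ℝ) (A : E) :
    taylorTerm f d (t • A) = t ^ d • taylorTerm f d A := by
  have h := (iteratedFDeriv ℝ d f 0).map_smul_univ (fun _ => t) (fun _ => A)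
  rw [Finset.prod_const, Finset.card_univ, Fintype.card_fin] at h
  rw [taylorTerm, h, taylorTerm, smul_comm]

theorem continuous_taylorTerm (f : E → ℂ) (d : ℕ) : Continuous (taylorTerm f d) := by
  have h : Continuous fun A : E => iteratedFDeriv ℝ d f 0 (fun _ => A) :=
    (iteratedFDeriv ℝ d f 0).cont.comp (continuous_pi fun _ => continuous_id)
  exact h.const_smul (d.factorial : ℝ)⁻¹

theorem exists_one_lt_forall_smul_mem {Ω C : Set E} (hΩ : IsOpen Ω) (hC : IsCompact C)
    (hCΩ : C ⊆ Ω) : ∃ t : ℝ, 1 < t ∧ ∀ A ∈ C, t • A ∈ Ω := by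
  have h : ∀ᶠ t in 𝓝 (1 : ℝ), ∀ A ∈ C, t • A ∈ Ω := by
    refine hC.eventually_forall_of_forall_eventually fun A hA => ?_
    refine (continuous_smul (M := ℝ) (X := E)).continuousAt.eventually_mem (hΩ.mem_nhds ?_)
    simpa using hCΩ hA
  obtain ⟨t, h1, h2⟩ :=
    ((h.filter_mono (nhdsWithin_le_nhds (s := Set.Ioi 1))).and self_mem_nhdsWithin).exists
  exact ⟨t, h2, h1⟩

/-- For some `t > 1` the dilate `t C` still lies in `Ω`. Eventually consecutive partial sums at `t
A` are both within `1` of `f (t A)`, so a single term there has norm at most `2`; by homogeneity it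
is at most `2 t⁻ᵈ` at `A`. -/
theorem exists_summable_norm_taylorTerm_le {f : E → ℂ} {Ω C : Set E} (hΩ : IsOpen Ω)
    (hC : IsCompact C) (hCΩ : C ⊆ Ω)
    (hf : TendstoUniformlyOn (fun N A => ∑ d ∈ Finset.range (N + 1), taylorTerm f d A) f
      atTop Ω) :
    ∃ b : ℕ → ℝ, Summable b ∧ ∀ d, ∀ A ∈ C, ‖taylorTerm f d A‖ ≤ b d := by
  obtain ⟨t, ht, htC⟩ := exists_one_lt_forall_smul_mem hΩ hC hCΩ
  have ht0 : 0 < t := one_pos.trans ht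
  choose c hc using fun d => hC.exists_bound_of_continuousOn (continuous_taylorTerm f d).continuousOn
  obtain ⟨N, hN⟩ := eventually_atTop.1 (Metric.tendstoUniformlyOn_iff.1 hf 1 one_pos)
  have hlarge : ∀ d ≥ N, ∀ A ∈ C, ‖taylorTerm f (d + 1) A‖ ≤ 2 * t⁻¹ ^ (d + 1) := by
    intro d hd A hA
    have h1 := hN d hd _ (htC A hA)
    have h2 := hN (d + 1) (hd.trans d.le_succ) _ (htC A hA)
    rw [Finset.sum_range_succ] at h2
    have h3 : ‖taylorTerm f (d + 1) (t • A)‖ ≤ 2 := by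
      have h4 := dist_triangle_left (∑ d ∈ Finset.range (d + 1), taylorTerm f d (t • A))
        (∑ d ∈ Finset.range (d + 1), taylorTerm f d (t • A) + taylorTerm f (d + 1) (t • A))
        (f (t • A))
      rw [dist_self_add_right] at h4
      linarith
    rw [taylorTerm_smul, norm_smul, norm_pow, Real.norm_of_nonneg ht0.le] at h3
    rw [inv_pow, ← div_eq_mul_inv, le_div_iff₀ (by positivity)]
    linarith
  refine ⟨fun d => if d < N + 1 then c d else 2 * t⁻¹ ^ d, ?_, fun d A hA => ?_⟩
  · rw [← summable_nat_add_iff (N + 1)]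
    have : Summable fun d : ℕ => 2 * t⁻¹ ^ (d + (N + 1)) :=
      ((summable_nat_add_iff (N + 1)).2
        (summable_geometric_of_lt_one (inv_nonneg.2 ht0.le) (inv_lt_one_of_one_lt₀ ht))).mul_left 2
    refine this.congr fun d => ?_
    rw [if_neg (by omega)]
  · dsimp only
    split_ifs with h
    · exact hc d A hA
    · obtain ⟨d, rfl⟩ : ∃ d', d = d' + 1 := ⟨d - 1, by omega⟩
      exact hlarge d (by omega) A hA

/-- Along the line through `A` the function is the one-variable polynomial with terms `t^(w i) q i
A`, whose derivatives at `0` are explicit. -/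
theorem taylorTerm_sum_of_homogeneous {ι : Type*} (s : Finset ι) (q : ι → E → ℂ) (w : ι → ℕ)
    (hq : ∀ i ∈ s, ContDiff ℝ ∞ (q i)) (hw : ∀ i ∈ s, ∀ (t : ℝ) A, q i (t • A) = t ^ w i • q i A)
    (d : ℕ) (A : E) :
    taylorTerm (fun A => ∑ i ∈ s, q i A) d A = ∑ i ∈ s, if w i = d then q i A else 0 := by
  have hsum : ContDiff ℝ ∞ fun A => ∑ i ∈ s, q i A := ContDiff.sum hq
  have h := ContinuousLinearMap.iteratedFDeriv_comp_right (ContinuousLinearMap.toSpanSingleton ℝ A)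
    hsum (0 : ℝ) (i := d) (by exact_mod_cast le_top)
  have h1 := congrArg (fun M => M fun _ => (1 : ℝ)) h
  simp only [ContinuousMultilinearMap.compContinuousLinearMap_apply,
    ContinuousLinearMap.toSpanSingleton_apply, zero_smul, one_smul] at h1
  have h2 : (fun A => ∑ i ∈ s, q i A) ∘ ContinuousLinearMap.toSpanSingleton ℝ A =
      fun t : ℝ => ∑ i ∈ s, t ^ w i • q i A := by
    funext t
    exact Finset.sum_congr rfl fun i hi => hw i hi t A
  rw [taylorTerm, ← h1, h2, iteratedFDeriv_fun_sum_apply fun i _ => by fun_prop,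
    sum_apply, Finset.smul_sum]
  refine Finset.sum_congr rfl fun i _ => ?_
  have h3 := iteratedDeriv_smul_const (n := d) (x := (0 : ℝ)) (f := fun t : ℝ => t ^ w i)
    (by fun_prop) (q i A)
  rw [iteratedDeriv_eq_iteratedFDeriv] at h3
  rw [h3, iteratedDeriv_fun_pow_zero]
  split_ifs with h4 h5 h5
  · subst h4
    rw [smul_smul, inv_mul_cancel₀ (by positivity), one_smul]
  · exact absurd h4.symm h5
  · exact absurd h5.symm h4
  · simp

theorem sum_taylorTerm_eq_of_homogeneous {ι : Type*} (s : Finset ι) (q : ι → E → ℂ) (w : ι → ℕ)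
    (hq : ∀ i ∈ s, ContDiff ℝ ∞ (q i)) (hw : ∀ i ∈ s, ∀ (t : ℝ) A, q i (t • A) = t ^ w i • q i A)
    {N : ℕ} (hN : ∀ i ∈ s, w i ≤ N) (A : E) :
    ∑ d ∈ Finset.range (N + 1), taylorTerm (fun A => ∑ i ∈ s, q i A) d A = ∑ i ∈ s, q i A := by
  simp_rw [taylorTerm_sum_of_homogeneous s q w hq hw]
  rw [Finset.sum_comm]
  refine Finset.sum_congr rfl fun i hi => ?_
  rw [Finset.sum_ite_eq, if_pos (Finset.mem_range.2 (Nat.lt_succ_of_le (hN i hi)))]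

end Taylor

/-! ### Polynomial functions and summation of the series. -/

section Series

variable {K : Type*} [NormedRing K] [StarRing K] [NormedAlgebra ℝ K]
  [ContinuousStar K] {β : ℕ} [NeZero β] {e : Fin β → K} {re : K →ₗ[ℝ] ℝ}

theorem coordinate_smul (t : ℝ) {n k : ℕ} (A : Matrix (Fin n) (Fin k) K) (c : Coord n k β) :
    coordinate e re (t • A) c = t * coordinate e re A c :=
  map_smul (entryRe re (star (e c.2.2)) c.1 c.2.1) t A

theorem contDiff_coordinate (S : IsScalarSystem e re) {n k : ℕ} (c : Coord n k β) :
    ContDiff ℝ ∞ fun A : Matrix (Fin n) (Fin k) K => coordinate e re A c :=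
  (⟨entryRe re (star (e c.2.2)) c.1 c.2.1, continuous_coordinate S c⟩ :
    Matrix (Fin n) (Fin k) K →L[ℝ] ℝ).contDiff

theorem inAnalyticClass_of_isPolynomialFunction (S : IsScalarSystem e re) {n k : ℕ}
    {f : Matrix (Fin n) (Fin k) K → ℂ} (hf : IsPolynomialFunction e f) : InAnalyticClass f := by
  obtain ⟨p, hp⟩ := hf
  set q : (Coord n k β →₀ ℕ) → Matrix (Fin n) (Fin k) K → ℂ := fun α A =>
    p.coeff α * ∏ c, (coordinate e re A c : ℂ) ^ α c with hq
  have hfq : f = fun A => ∑ α ∈ p.support, q α A := by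
    funext A
    rw [← MvPolynomial.eval_eq' (fun c => (coordinate e re A c : ℂ)) p, ← hp,
      sum_coordinate_smul_direction S]
  have hsmooth : ∀ α ∈ p.support, ContDiff ℝ ∞ (q α) := by
    intro α _
    refine contDiff_const.mul (contDiff_prod fun c _ => ContDiff.pow ?_ _)
    exact Complex.ofRealCLM.contDiff.comp (contDiff_coordinate S c)
  have hhom : ∀ α ∈ p.support, ∀ (t : ℝ) A, q α (t • A) = t ^ (∑ c, α c) • q α A := by
    intro α _ t A
    simp only [hq, coordinate_smul, Complex.ofReal_mul, mul_pow, Finset.prod_mul_distrib,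
      Finset.prod_pow_eq_pow_sum, Complex.real_smul, Complex.ofReal_pow]
    ring
  refine ⟨Set.univ, isOpen_univ, fun _ _ _ _ => Set.mem_univ _, ?_, ?_⟩
  · rw [hfq]
    exact (ContDiff.sum hsmooth).contDiffOn
  · rw [Metric.tendstoUniformlyOn_iff]
    intro ε hε
    filter_upwards [eventually_ge_atTop (p.support.sup fun α => ∑ c, α c)] with N hN A _
    have h := sum_taylorTerm_eq_of_homogeneous p.support q (fun α => ∑ c, α c) hsmooth hhom
      (fun α hα => (Finset.le_sup (f := fun α : Coord n k β →₀ ℕ => ∑ c, α c) hα).trans hN) A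
    rw [← hfq] at h
    rw [show f A = ∑ d ∈ Finset.range (N + 1), taylorTerm f d A from by rw [h, hfq]]
    exact (dist_self _).trans_lt hε

variable {m : ℕ} [CompactSpace (unitaryGp K (m + 2))]

theorem integral_taylorTerm_of_odd {n k : ℕ} [CompactSpace (unitaryGp K n)]
    [FiniteDimensional ℝ K] (f : Matrix (Fin n) (Fin k) K → ℂ) {d : ℕ} (hd : Odd d) :
    ∫ A, taylorTerm f d A ∂(stiefelMeasure K n k) = 0 := by
  have h := integral_mul_left (K := K) (n := n) (k := k) (continuous_taylorTerm f d) (U := -1)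
    (Unitary.mem_iff.2 (by simp))
  have h2 : ∀ A : Matrix (Fin n) (Fin k) K, taylorTerm f d ((-1 : Matrix (Fin n) (Fin n) K) * A) =
      -taylorTerm f d A := by
    intro A
    have h3 := taylorTerm_smul f d (-1) A
    rw [hd.neg_one_pow, neg_one_smul, neg_one_smul] at h3
    rw [Matrix.neg_mul, Matrix.one_mul, h3]
  simp_rw [h2] at h
  rw [integral_neg] at h
  exact self_eq_neg.1 h.symm

theorem hasSum_pizzettiTerm (S : IsScalarSystem e re)
    {I₁ I₂ : MvPolynomial (Coord (m + 2) 2 β) ℂ}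
    (h₁ : ∀ y : Coord (m + 2) 2 β → ℝ, MvPolynomial.eval (fun c => (y c : ℂ)) I₁ =
      (gramTrace re (∑ c, y c • direction e c) : ℂ))
    (h₂ : ∀ y : Coord (m + 2) 2 β → ℝ, MvPolynomial.eval (fun c => (y c : ℂ)) I₂ =
      (gramDet re (∑ c, y c • direction e c) : ℂ))
    {f : Matrix (Fin (m + 2)) (Fin 2) K → ℂ} (hf : InAnalyticClass f) :
    HasSum (pizzettiTerm e I₁ I₂ f) (∫ A, f A ∂(stiefelMeasure K (m + 2) 2)) := by
  have := S.finiteDimensional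
  obtain ⟨Ω, hΩ, hstar, hsmooth, hlim⟩ := hf
  have hlim' : TendstoUniformlyOn (fun N A => ∑ d ∈ Finset.range (N + 1), taylorTerm f d A) f
      atTop Ω := hlim
  have hframe := frame_mem_stiefel (K := K) (n := m + 2) (k := 2) (by omega)
  have h0 : (0 : Matrix (Fin (m + 2)) (Fin 2) K) ∈ Ω := by
    simpa using hstar _ hframe 0 (by simp)
  -- The orbit of `frame` carries the measure and is compact as an image of the group; transitivity
  -- of the action on the Stiefel manifold is not required.
  set C := Set.range fun U : unitaryGp K (m + 2) =>
      (U : Matrix (Fin (m + 2)) (Fin (m + 2)) K) * frame K (m + 2) 2 with hC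
  have hCΩ : C ⊆ Ω := by
    rintro _ ⟨U, rfl⟩
    simpa using hstar _ (mul_mem_stiefel U hframe) 1 (by simp)
  obtain ⟨b, hb, hbound⟩ :=
    exists_summable_norm_taylorTerm_le hΩ isCompact_range_mul_frame hCΩ hlim'
  have hae := ae_mem_range_mul_frame (K := K) (n := m + 2) (k := 2)
  have hsum : HasSum (fun d => ∫ A, taylorTerm f d A ∂(stiefelMeasure K (m + 2) 2))
      (∫ A, f A ∂(stiefelMeasure K (m + 2) 2)) := by
    refine hasSum_integral_of_dominated_convergence (fun d _ => b d)
      (fun d => (integrable_stiefelMeasure (continuous_taylorTerm f d)).aestronglyMeasurable)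
      (fun d => hae.mono fun A hA => hbound d A hA) (Eventually.of_forall fun _ => hb)
      (integrable_const _) (hae.mono fun A hA => ?_)
    have hs : Summable fun d => taylorTerm f d A :=
      Summable.of_norm_bounded hb fun d => hbound d A hA
    rw [hs.hasSum_iff_tendsto_nat, ← tendsto_add_atTop_iff_nat 1]
    exact hlim'.tendsto_at (hCΩ hA)
  have hinj : Function.Injective fun j : ℕ => 2 * j := fun a b h => by simpa using h
  -- The terms outside the range of `j ↦ 2j` are those of odd degree, whose integrals vanish.
  rw [← hinj.hasSum_iff] at hsum
  · rwa [show (fun d => ∫ A, taylorTerm f d A ∂(stiefelMeasure K (m + 2) 2)) ∘ (fun j => 2 * j) =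
      pizzettiTerm e I₁ I₂ f from
        funext fun j => integral_taylor_eq_pizzettiTerm S h₁ h₂ hΩ h0 hsmooth j] at hsum
  · intro d hd
    refine integral_taylorTerm_of_odd f (Nat.not_even_iff_odd.1 fun h => hd ?_)
    obtain ⟨j, rfl⟩ := even_iff_two_dvd.1 h
    exact ⟨j, rfl⟩

end Series

end Pizzetti

theorem theorem5p1 (n : ℕ) (hn : 2 ≤ n) :
    -- the real case
    ((∀ f : Matrix (Fin n) (Fin 2) ℝ → ℂ,
        Pizzetti.IsPolynomialFunction Pizzetti.realUnits f → Pizzetti.InAnalyticClass f) ∧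
      ∀ f : Matrix (Fin n) (Fin 2) ℝ → ℂ, Pizzetti.InAnalyticClass f →
        HasSum
          (Pizzetti.pizzettiTerm Pizzetti.realUnits (Pizzetti.I₁Real n) (Pizzetti.I₂Real n) f)
          (∫ A, f A ∂(Pizzetti.stiefelMeasure ℝ n 2))) ∧
    -- the complex case
    ((∀ f : Matrix (Fin n) (Fin 2) ℂ → ℂ,
        Pizzetti.IsPolynomialFunction Pizzetti.complexUnits f → Pizzetti.InAnalyticClass f) ∧
      ∀ f : Matrix (Fin n) (Fin 2) ℂ → ℂ, Pizzetti.InAnalyticClass f →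
        HasSum
          (Pizzetti.pizzettiTerm Pizzetti.complexUnits (Pizzetti.I₁Complex n)
            (Pizzetti.I₂Complex n) f)
          (∫ A, f A ∂(Pizzetti.stiefelMeasure ℂ n 2))) ∧
    -- the quaternionic case
    ((∀ f : Matrix (Fin n) (Fin 2) ℍ[ℝ] → ℂ,
        Pizzetti.IsPolynomialFunction Pizzetti.quaternionUnits f → Pizzetti.InAnalyticClass f) ∧
      ∀ f : Matrix (Fin n) (Fin 2) ℍ[ℝ] → ℂ, Pizzetti.InAnalyticClass f →
        HasSum
          (Pizzetti.pizzettiTerm Pizzetti.quaternionUnits (Pizzetti.I₁Quaternion n)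
            (Pizzetti.I₂Quaternion n) f)
          (∫ A, f A ∂(Pizzetti.stiefelMeasure ℍ[ℝ] n 2))) := by
  -- In this form the row indices `0` and `1` are visibly distinct, and `m` counts the rows beyond
  -- them.
  obtain ⟨m, rfl⟩ : ∃ m, n = m + 2 := ⟨n - 2, by omega⟩
  open Pizzetti in
  exact ⟨⟨fun _ => inAnalyticClass_of_isPolynomialFunction isScalarSystem_real,
      fun _ => hasSum_pizzettiTerm isScalarSystem_real eval_I₁Real eval_I₂Real⟩,
    ⟨fun _ => inAnalyticClass_of_isPolynomialFunction isScalarSystem_complex,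
      fun _ => hasSum_pizzettiTerm isScalarSystem_complex eval_I₁Complex eval_I₂Complex⟩,
    ⟨fun _ => inAnalyticClass_of_isPolynomialFunction isScalarSystem_quaternion,
      fun _ => hasSum_pizzettiTerm isScalarSystem_quaternion eval_I₁Quaternion eval_I₂Quaternion⟩⟩
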